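/- Let $q\in\mathbb C$ with $0<|q|<1$. For $a\in\mathbb C$ put $(a)_\infty=\prod_{j\ge 0}(1-aq^j)$, $(a)_k=\prod_{j=0}^{k-1}(1-aq^j)$ for integers $k\ge 0$, $(a)_k=\bigl(\prod_{j=1}^{-k}(1-aq^{-j})\bigr)^{-1}$ for integers $k<0$, and for $x\neq 0$ let $\theta(x)=(x)_\infty(q/x)_\infty$. Write $${}_3\psi_3\left(\begin{matrix}c_1,c_2,c_3\\ d_1,d_2,d_3\end{matrix};z\right)=\sum_{k=-\infty}^{\infty}\frac{(c_1)_k(c_2)_k(c_3)_k}{(d_1)_k(d_2)_k(d_3)_k}\,z^k ,$$ where for $k<0$ the factor $1/(d)_k$ is understood as $\prod_{j=1}^{-k}(1-dq^{-j})$. Let $a_1,a_2,a_3,b_1,b_2,b_3\in\mathbb C$ satisfy $a_1a_2a_3b_1b_2b_3=q$, put $t=a_1a_2a_3=q/(b_1b_2b_3)$, and define, for $\lambda\ne0$, \begin{align*} f_1(\lambda)&=\lambda\,\theta(b_1/\lambda)\theta(b_2/\lambda)\theta(b_3/\lambda),\\ f_2(\lambda)&=\lambda^{-1}\,\theta(a_1\lambda)\theta(a_2\lambda)\theta(a_3\lambda),\\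 f_3(\lambda)&=\prod_{j=1}^3(q/a_j\lambda)_\infty(q\lambda/b_j)_\infty\cdot{}_3\psi_3\left(\begin{matrix}a_1\lambda,a_2\lambda,a_3\lambda\\ q\lambda/b_1,q\lambda/b_2,q\lambda/b_3\end{matrix};q\right). \end{align*} Let $\lambda_1,\lambda_2,\lambda_3\in\mathbb C\setminus\{0\}$ be such that no term of the series defining $f_3(\lambda_i)$ has a vanishing denominator, that is, $a_j\lambda_i\ne q^{n}$ and $b_j/\lambda_i\neq q^{n}$ for all $i,j\in\{1,2,3\}$ and all integers $n\ge1$. Then the series defining $f_3(\lambda_1),f_3(\lambda_2),f_3(\lambda_3)$ converge absolutely, and $$\det_{1\le i,j\le 3}\bigl(f_j(\lambda_i)\bigr)=\frac{(q)_\infty\,\theta(t\lambda_1\lambda_2\lambda_3)}{\lambda_1\lambda_2\lambda_3}\prod_{i,j=1}^3(q/a_ib_j)_\infty\prod_{1\le i<j\le3}\lambda_j\,\theta(\lambda_i/\lambda_j).$$ -/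

import Mathlib

noncomputable section

namespace BilateralSaalschutz

open Finset

/-- The `q`-shifted factorial `(a)_k` for `k ∈ ℤ`. For `k = -(n+1)` it is
`((1 - a q⁻¹) ⋯ (1 - a q^{-(n+1)}))⁻¹`. -/
def qPoch (q a : ℂ) : ℤ → ℂ
  | Int.ofNat n => ∏ i ∈ range n, (1 - a * q ^ i)
  | Int.negSucc n => (∏ i ∈ range (n + 1), (1 - a * (q ^ (i + 1))⁻¹))⁻¹

/-- The infinite `q`-shifted factorial `(a)_∞ = ∏_{j ≥ 0} (1 - a q^j)`. -/
def qPochInf (q a : ℂ) : ℂ := ∏' j : ℕ, (1 - a * q ^ j)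

/-- For `|q| < 1` the product defining `(a)_∞` converges. -/
theorem multipliable_qPochInf {q : ℂ} (hq : ‖q‖ < 1) (a : ℂ) :
    Multipliable fun j : ℕ => 1 - a * q ^ j := by
  have h : Summable fun j : ℕ => ‖-(a * q ^ j)‖ := by
    simpa [norm_mul, norm_pow] using
      (summable_geometric_of_lt_one (norm_nonneg q) hq).mul_left ‖a‖
  simpa [sub_eq_add_neg] using multipliable_one_add_of_summable h

/-- The theta function `θ(x) = (x)_∞ (q/x)_∞`. -/
def theta (q x : ℂ) : ℂ := qPochInf q x * qPochInf q (q / x)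

/-- The `k`-th term of the bilateral basic hypergeometric series `ᵣψᵣ(a; b; z)`.
If `1 / (b j)_k` is a product with a zero factor (`k < 0`), it is `0`, as it should be. -/
def psiTerm {r : ℕ} (q : ℂ) (a b : Fin r → ℂ) (z : ℂ) (k : ℤ) : ℂ :=
  (∏ j, qPoch q (a j) k) / (∏ j, qPoch q (b j) k) * z ^ k

/-- The bilateral basic hypergeometric series `ᵣψᵣ(a; b; z)`. -/
def psi {r : ℕ} (q : ℂ) (a b : Fin r → ℂ) (z : ℂ) : ℂ :=
  ∑' k : ℤ, psiTerm q a b z k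

/-- `f₁(x) = x θ(b₁/x, b₂/x, b₃/x)`. -/
def f₁ (q : ℂ) (b : Fin 3 → ℂ) (x : ℂ) : ℂ := x * ∏ j, theta q (b j / x)

/-- `f₂(x) = x⁻¹ θ(a₁x, a₂x, a₃x)`. -/
def f₂ (q : ℂ) (a : Fin 3 → ℂ) (x : ℂ) : ℂ := x⁻¹ * ∏ j, theta q (a j * x)

/-- `f₃(x) = ∏ⱼ (q/(aⱼx), qx/bⱼ)_∞ ⬝ ₃ψ₃(a₁x, a₂x, a₃x; qx/b₁, qx/b₂, qx/b₃; q)`. -/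
def f₃ (q : ℂ) (a b : Fin 3 → ℂ) (x : ℂ) : ℂ :=
  (∏ j, qPochInf q (q / (a j * x)) * qPochInf q (q * x / b j)) *
    psi q (fun j => a j * x) (fun j => q * x / b j) q

end BilateralSaalschutz

end

noncomputable section

namespace BilateralSaalschutz

open Finset

/-! Absorbing the prefactor of `f₃` into the series gives `saalSeries`, which has no denominators
and is holomorphic in all nonzero parameters. When the product of all six parameters is 1, a
telescoping sum (`saalSeries_contiguity`) writes a combination of the two series with `x 1`,
respectively `x 0`, multiplied by `q` in terms of theta products. In the determinant these theta
products lie in the span of the first two columns, so the two shifted determinants are proportional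
(`saalDet_contiguity`).

Hence the determinant divided by `phi q b (a₀ * s) * phi q b (a₁ / s)` is invariant under `s ↦ q s`
when `a₀, a₁` are replaced by `a₀ s, a₁ / s`. If `a₀, a₁` are large, this quotient has no poles on
an annulus containing a fundamental domain, so the maximum principle makes it constant; analytic
continuation removes the size condition (`saalDet_move`). Thus the determinant divided by all
`(q/aᵢbⱼ)_∞` depends on `a` only through its product, and, by the symmetry exchanging `a` and `b`,
likewise for `b`.

It remains to evaluate one choice of parameters, made so that four theta entries vanish and one
series has a single term (`saalDet_special`). The divisions along the way need generic `lam`;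
density and continuity then give every nonzero `lam` (`saalDet_eq`). -/

/-! ### Shifted factorials and theta functions. -/

/-- The finite `q`-shifted factorial `(a)_n` for `n ∈ ℕ`. -/
def qPochNat (q a : ℂ) (n : ℕ) : ℂ := ∏ i ∈ range n, (1 - a * q ^ i)

@[simp] lemma qPochNat_zero (q a : ℂ) : qPochNat q a 0 = 1 := by simp [qPochNat]

lemma qPochNat_succ (q a : ℂ) (n : ℕ) :
    qPochNat q a (n + 1) = qPochNat q a n * (1 - a * q ^ n) := by
  simp [qPochNat, prod_range_succ]

lemma qPochNat_succ' (q a : ℂ) (n : ℕ) :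
    qPochNat q a (n + 1) = (1 - a) * qPochNat q (q * a) n := by
  rw [qPochNat, prod_range_succ', qPochNat, mul_comm]
  congr 1
  · simp
  · exact prod_congr rfl fun i _ => by ring

lemma qPochNat_one_succ (q : ℂ) (n : ℕ) : qPochNat q 1 (n + 1) = 0 := by
  simp [qPochNat_succ']

lemma norm_qPochNat_le {q : ℂ} (hq : ‖q‖ < 1) (a : ℂ) (n : ℕ) :
    ‖qPochNat q a n‖ ≤ Real.exp (‖a‖ * (1 - ‖q‖)⁻¹) := by
  calc ‖qPochNat q a n‖ ≤ ∏ i ∈ range n, (1 + ‖a‖ * ‖q‖ ^ i) := by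
        rw [qPochNat, norm_prod]
        refine prod_le_prod (fun _ _ => norm_nonneg _) fun i _ => ?_
        refine (norm_sub_le _ _).trans ?_
        simp
    _ ≤ Real.exp (∑ i ∈ range n, ‖a‖ * ‖q‖ ^ i) :=
        Real.prod_one_add_le_exp_sum _ fun i => by positivity
    _ ≤ _ := by
        rw [← mul_sum]
        gcongr
        rw [← tsum_geometric_of_lt_one (norm_nonneg q) hq]
        exact (summable_geometric_of_lt_one (norm_nonneg q) hq).sum_le_tsum _
          fun _ _ => by positivity

lemma tendsto_qPochNat {q : ℂ} (hq : ‖q‖ < 1) (a : ℂ) :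
    Filter.Tendsto (qPochNat q a) Filter.atTop (nhds (qPochInf q a)) :=
  (multipliable_qPochInf hq a).hasProd.tendsto_prod_nat

lemma norm_qPochInf_le {q : ℂ} (hq : ‖q‖ < 1) (a : ℂ) :
    ‖qPochInf q a‖ ≤ Real.exp (‖a‖ * (1 - ‖q‖)⁻¹) :=
  le_of_tendsto (tendsto_qPochNat hq a).norm (.of_forall fun n => norm_qPochNat_le hq a n)

lemma qPochInf_eq_qPochNat_mul {q : ℂ} (hq : ‖q‖ < 1) (a : ℂ) (n : ℕ) :
    qPochInf q a = qPochNat q a n * qPochInf q (a * q ^ n) := by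
  have h : (fun j : ℕ => 1 - a * q ^ n * q ^ j) = fun j : ℕ => 1 - a * q ^ (j + n) := by
    ext j; rw [pow_add]; ring
  have h2 : Multipliable fun j : ℕ => 1 - a * q ^ (j + n) := h ▸ multipliable_qPochInf hq (a * q ^ n)
  have h3 := Multipliable.prod_mul_tprod_nat_mul' (f := fun j : ℕ => 1 - a * q ^ j) h2
  unfold qPochInf qPochNat
  rw [h]
  exact h3.symm

lemma qPochInf_eq_mul {q : ℂ} (hq : ‖q‖ < 1) (a : ℂ) :
    qPochInf q a = (1 - a) * qPochInf q (q * a) := by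
  simpa [qPochNat, mul_comm q] using qPochInf_eq_qPochNat_mul hq a 1

lemma qPochInf_one {q : ℂ} (hq : ‖q‖ < 1) : qPochInf q 1 = 0 := by
  simp [qPochInf_eq_mul hq 1]

lemma qPochInf_ne_zero {q : ℂ} (hq : ‖q‖ < 1) {a : ℂ} (h : ∀ n : ℕ, a * q ^ n ≠ 1) :
    qPochInf q a ≠ 0 := by
  have h1 := tprod_one_add_ne_zero_of_summable (f := fun n : ℕ => -(a * q ^ n))
    (fun n => by rw [← sub_eq_add_neg, sub_ne_zero]; exact (h n).symm)
    (by simpa [norm_mul, norm_pow] using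
      (summable_geometric_of_lt_one (norm_nonneg q) hq).mul_left ‖a‖)
  simpa [qPochInf, sub_eq_add_neg] using h1

lemma qPochInf_ne_zero_of_norm_lt_one {q : ℂ} (hq : ‖q‖ < 1) {a : ℂ} (h : ‖a‖ < 1) :
    qPochInf q a ≠ 0 := by
  refine qPochInf_ne_zero hq fun n hn => ?_
  have : ‖a * q ^ n‖ < 1 := by
    rw [norm_mul, norm_pow]
    exact (mul_le_of_le_one_right (norm_nonneg _) (pow_le_one₀ (norm_nonneg _) hq.le)).trans_lt h
  rw [hn] at this
  simp at this

lemma differentiable_qPochInf {q : ℂ} (hq : ‖q‖ < 1) : Differentiable ℂ (qPochInf q) := by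
  intro a
  have hu : Summable fun j : ℕ => (‖a‖ + 1) * ‖q‖ ^ j :=
    (summable_geometric_of_lt_one (norm_nonneg q) hq).mul_left _
  have h := hu.hasProdLocallyUniformlyOn_nat_one_add (f := fun j (z : ℂ) => -(z * q ^ j))
    (K := Metric.ball 0 (‖a‖ + 1)) Metric.isOpen_ball
    (.of_forall fun n x hx => by
      rw [norm_neg, norm_mul, norm_pow]
      gcongr
      simpa using (mem_ball_zero_iff.1 hx).le)
    (fun i => by fun_prop)
  have h2 := (hasProdLocallyUniformlyOn_iff_tendstoLocallyUniformlyOn.1 h).differentiableOn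
    (.of_forall fun s => by fun_prop) Metric.isOpen_ball
  have h3 := h2.differentiableAt (x := a)
    (Metric.isOpen_ball.mem_nhds (by rw [mem_ball_zero_iff]; linarith))
  simpa [qPochInf, sub_eq_add_neg, Function.comp_def] using! h3

lemma continuous_qPochInf {q : ℂ} (hq : ‖q‖ < 1) : Continuous (qPochInf q) :=
  (differentiable_qPochInf hq).continuous

lemma theta_q_div {q : ℂ} (hq0 : q ≠ 0) {x : ℂ} : theta q (q / x) = theta q x := by
  rw [theta, theta, mul_comm, div_div_cancel₀ hq0]

lemma theta_q_mul {q : ℂ} (hq : ‖q‖ < 1) (hq0 : q ≠ 0) {x : ℂ} (hx : x ≠ 0) :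
    theta q (q * x) = -x⁻¹ * theta q x := by
  have h1 : q / (q * x) = x⁻¹ := by field_simp
  rw [theta, theta, h1, qPochInf_eq_mul hq x⁻¹, qPochInf_eq_mul hq x, ← div_eq_mul_inv]
  field_simp
  ring

lemma theta_inv {q : ℂ} (hq : ‖q‖ < 1) (hq0 : q ≠ 0) {x : ℂ} (hx : x ≠ 0) :
    theta q x⁻¹ = -x⁻¹ * theta q x := by
  rw [← theta_q_mul hq hq0 hx, ← theta_q_div hq0 (x := q * x)]
  congr 1
  field_simp

lemma theta_one {q : ℂ} (hq : ‖q‖ < 1) : theta q 1 = 0 := by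
  simp [theta, qPochInf_one hq]

lemma DifferentiableOn.qPochInf {q : ℂ} (hq : ‖q‖ < 1) {U : Set ℂ} {x : ℂ → ℂ}
    (hx : DifferentiableOn ℂ x U) : DifferentiableOn ℂ (fun s => qPochInf q (x s)) U :=
  (differentiable_qPochInf hq).comp_differentiableOn hx

lemma DifferentiableOn.qPochNat (q : ℂ) {U : Set ℂ} {x : ℂ → ℂ}
    (hx : DifferentiableOn ℂ x U) (n : ℕ) : DifferentiableOn ℂ (fun s => qPochNat q (x s) n) U := by
  unfold BilateralSaalschutz.qPochNat
  fun_prop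

lemma DifferentiableOn.theta {q : ℂ} (hq : ‖q‖ < 1) {U : Set ℂ} {x : ℂ → ℂ}
    (hx : DifferentiableOn ℂ x U) (h0 : ∀ s ∈ U, x s ≠ 0) :
    DifferentiableOn ℂ (fun s => theta q (x s)) U :=
  (DifferentiableOn.qPochInf hq hx).mul
    (DifferentiableOn.qPochInf hq ((differentiableOn_const q).div hx h0))

/-! ### The series without denominators: convergence and holomorphy. -/

/-- The `k`-th term, `k ≥ 0`, of the series `saalSeries`. -/
def saalTerm (q : ℂ) (x y : Fin 3 → ℂ) (k : ℕ) : ℂ :=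
  q ^ k * ∏ j, (qPochInf q (q / x j) * qPochNat q (x j) k * qPochInf q (q ^ (k + 1) / y j))

/-- The series `∏ⱼ (q/xⱼ, q/yⱼ)_∞ ⬝ ₃ψ₃(x₁, x₂, x₃; q/y₁, q/y₂, q/y₃; q)` with `x₁x₂x₃y₁y₂y₃ = q`,
written without denominators. -/
def saalSeries (q : ℂ) (x y : Fin 3 → ℂ) : ℂ :=
  ∑' k : ℕ, saalTerm q x y k + ∑' k : ℕ, saalTerm q y x (k + 1)

/-- Each of the nine shifted factorials has the same exponential bound, and the geometric factor
remains. Uniformity in `x, y` is what the Weierstrass test for holomorphy needs. -/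
lemma norm_saalTerm_le {q : ℂ} (hq : ‖q‖ < 1) {x y : Fin 3 → ℂ} {M : ℝ}
    (hx : ∀ j, ‖x j‖ ≤ M) (hx' : ∀ j, ‖q / x j‖ ≤ M) (hy : ∀ j, ‖q / y j‖ ≤ M) (k : ℕ) :
    ‖saalTerm q x y k‖ ≤ Real.exp (M * (1 - ‖q‖)⁻¹) ^ 9 * ‖q‖ ^ k := by
  have h1q : 0 ≤ (1 - ‖q‖)⁻¹ := by
    rw [inv_nonneg]; linarith
  rw [saalTerm, norm_mul, norm_pow, mul_comm, norm_prod]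
  gcongr
  calc ∏ j, ‖qPochInf q (q / x j) * qPochNat q (x j) k * qPochInf q (q ^ (k + 1) / y j)‖
      ≤ ∏ _j : Fin 3, (Real.exp (M * (1 - ‖q‖)⁻¹) * Real.exp (M * (1 - ‖q‖)⁻¹) *
          Real.exp (M * (1 - ‖q‖)⁻¹)) := by
        refine prod_le_prod (fun _ _ => norm_nonneg _) fun j _ => ?_
        rw [norm_mul, norm_mul]
        gcongr
        · exact (norm_qPochInf_le hq _).trans (by gcongr; exact hx' j)
        · exact (norm_qPochNat_le hq _ _).trans (by gcongr; exact hx j)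
        · refine (norm_qPochInf_le hq _).trans ?_
          gcongr
          refine le_trans ?_ (hy j)
          rw [pow_succ, mul_div_assoc, norm_mul, norm_pow]
          exact mul_le_of_le_one_left (norm_nonneg _) (pow_le_one₀ (norm_nonneg _) hq.le)
    _ = _ := by simp; ring

lemma exists_norm_bound (q : ℂ) (x y : Fin 3 → ℂ) :
    ∃ M : ℝ, ∀ j, ‖x j‖ < M ∧ ‖q / x j‖ < M ∧ ‖q / y j‖ < M ∧ ‖y j‖ < M := by
  refine ⟨(∑ j, (‖x j‖ + ‖q / x j‖ + ‖q / y j‖ + ‖y j‖)) + 1, fun j => ?_⟩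
  have := single_le_sum (f := fun j => ‖x j‖ + ‖q / x j‖ + ‖q / y j‖ + ‖y j‖)
    (fun _ _ => by positivity) (mem_univ j)
  have h1 := norm_nonneg (x j)
  have h2 := norm_nonneg (y j)
  have h3 := norm_nonneg (q / x j)
  have h4 := norm_nonneg (q / y j)
  exact ⟨by linarith, by linarith, by linarith, by linarith⟩

lemma summable_saalTerm {q : ℂ} (hq : ‖q‖ < 1) (x y : Fin 3 → ℂ) :
    Summable (saalTerm q x y) := by
  obtain ⟨M, hM⟩ := exists_norm_bound q x y
  exact .of_norm_bounded ((summable_geometric_of_lt_one (norm_nonneg q) hq).mul_left _)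
    (norm_saalTerm_le hq (fun j => (hM j).1.le) (fun j => (hM j).2.1.le)
      fun j => (hM j).2.2.1.le)

lemma saalTerm_zero_comm (q : ℂ) (x y : Fin 3 → ℂ) : saalTerm q x y 0 = saalTerm q y x 0 := by
  simp [saalTerm, mul_comm]

lemma saalSeries_comm {q : ℂ} (hq : ‖q‖ < 1) (x y : Fin 3 → ℂ) :
    saalSeries q x y = saalSeries q y x := by
  rw [saalSeries, saalSeries, (summable_saalTerm hq x y).tsum_eq_zero_add,
    (summable_saalTerm hq y x).tsum_eq_zero_add, saalTerm_zero_comm]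
  ring

lemma DifferentiableOn.saalTerm {q : ℂ} (hq : ‖q‖ < 1) {U : Set ℂ} {x y : ℂ → Fin 3 → ℂ}
    (hx : ∀ j, DifferentiableOn ℂ (fun s => x s j) U)
    (hy : ∀ j, DifferentiableOn ℂ (fun s => y s j) U)
    (hx0 : ∀ j, ∀ s ∈ U, x s j ≠ 0) (hy0 : ∀ j, ∀ s ∈ U, y s j ≠ 0) (k : ℕ) :
    DifferentiableOn ℂ (fun s => saalTerm q (x s) (y s) k) U := by
  unfold BilateralSaalschutz.saalTerm
  refine (differentiableOn_const _).mul (DifferentiableOn.fun_finsetProd fun j _ => ?_)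
  exact ((DifferentiableOn.qPochInf hq ((differentiableOn_const q).div (hx j) (hx0 j))).mul
    (DifferentiableOn.qPochNat q (hx j) k)).mul
    (DifferentiableOn.qPochInf hq ((differentiableOn_const _).div (hy j) (hy0 j)))

lemma DifferentiableOn.saalSeries {q : ℂ} (hq : ‖q‖ < 1) {U : Set ℂ} (hU : IsOpen U)
    {x y : ℂ → Fin 3 → ℂ}
    (hx : ∀ j, DifferentiableOn ℂ (fun s => x s j) U)
    (hy : ∀ j, DifferentiableOn ℂ (fun s => y s j) U)
    (hx0 : ∀ j, ∀ s ∈ U, x s j ≠ 0) (hy0 : ∀ j, ∀ s ∈ U, y s j ≠ 0) :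
    DifferentiableOn ℂ (fun s => saalSeries q (x s) (y s)) U := by
  intro s hs
  obtain ⟨M, hM⟩ := exists_norm_bound q (x s) (y s)
  have hcx : ∀ j, ContinuousAt (fun s => x s j) s := fun j =>
    ((hx j).differentiableAt (hU.mem_nhds hs)).continuousAt
  have hcy : ∀ j, ContinuousAt (fun s => y s j) s := fun j =>
    ((hy j).differentiableAt (hU.mem_nhds hs)).continuousAt
  -- The strict bounds at `s` persist nearby. All four are kept because the negative half of the
  -- series has `x` and `y` exchanged.
  have hev : ∀ᶠ r in nhds s, r ∈ U ∧ ∀ j,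
      ‖x r j‖ < M ∧ ‖q / x r j‖ < M ∧ ‖q / y r j‖ < M ∧ ‖y r j‖ < M := by
    refine Filter.Eventually.and (hU.mem_nhds hs) (Filter.eventually_all.2 fun j => ?_)
    refine ((hcx j).norm.eventually_lt_const (hM j).1).and
      (((continuousAt_const.div (hcx j) (hx0 j s hs)).norm.eventually_lt_const (hM j).2.1).and
      (((continuousAt_const.div (hcy j) (hy0 j s hs)).norm.eventually_lt_const (hM j).2.2.1).and
      ((hcy j).norm.eventually_lt_const (hM j).2.2.2)))
  obtain ⟨V, hV, hVo, hsV⟩ := eventually_nhds_iff.1 hev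
  have hsum := (summable_geometric_of_lt_one (norm_nonneg q) hq).mul_left
    (Real.exp (M * (1 - ‖q‖)⁻¹) ^ 9)
  have hVU : V ⊆ U := fun r hr => (hV r hr).1
  refine DifferentiableAt.differentiableWithinAt
    (DifferentiableOn.differentiableAt (s := V) ?_ (hVo.mem_nhds hsV))
  refine DifferentiableOn.add ?_ ?_
  · exact Complex.differentiableOn_tsum_of_summable_norm hsum
      (fun k => (DifferentiableOn.saalTerm hq hx hy hx0 hy0 k).mono hVU) hVo fun k r hr =>
      norm_saalTerm_le hq (fun j => ((hV r hr).2 j).1.le) (fun j => ((hV r hr).2 j).2.1.le)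
        (fun j => ((hV r hr).2 j).2.2.1.le) k
  · exact Complex.differentiableOn_tsum_of_summable_norm
      ((summable_nat_add_iff (f := fun k : ℕ => Real.exp (M * (1 - ‖q‖)⁻¹) ^ 9 * ‖q‖ ^ k) 1).2 hsum)
      (fun k => (DifferentiableOn.saalTerm hq hy hx hy0 hx0 (k + 1)).mono hVU) hVo fun k r hr =>
      norm_saalTerm_le hq (fun j => ((hV r hr).2 j).2.2.2.le) (fun j => ((hV r hr).2 j).2.2.1.le)
        (fun j => ((hV r hr).2 j).2.1.le) (k + 1)

/-! ### Comparison with the bilateral series. -/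

lemma prod_one_sub_mul_inv_pow {q : ℂ} (hq0 : q ≠ 0) {x : ℂ} (hx : x ≠ 0) (n : ℕ) :
    ∏ i ∈ range n, (1 - x * (q ^ (i + 1))⁻¹) =
      x ^ n * (∏ i ∈ range n, -(q ^ (i + 1))⁻¹) * qPochNat q (q / x) n := by
  rw [qPochNat, ← card_range n, ← prod_const, card_range, ← prod_mul_distrib, ← prod_mul_distrib]
  refine prod_congr rfl fun i _ => ?_
  have := pow_ne_zero (i + 1) hq0
  field_simp
  ring

lemma qPochInf_mul_qPoch_natCast_div {q : ℂ} (hq : ‖q‖ < 1) {x y : ℂ}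
    (hy : ∀ n : ℕ, q / y * q ^ n ≠ 1) (n : ℕ) :
    qPochInf q (q / x) * qPochInf q (q / y) * (qPoch q x n / qPoch q (q / y) n) =
      qPochInf q (q / x) * qPochNat q x n * qPochInf q (q ^ (n + 1) / y) := by
  have h1 : qPoch q x n = qPochNat q x n := rfl
  have h2 : qPoch q (q / y) n = qPochNat q (q / y) n := rfl
  have h3 : qPochNat q (q / y) n ≠ 0 :=
    prod_ne_zero_iff.2 fun i _ => sub_ne_zero.2 (hy i).symm
  rw [h1, h2, qPochInf_eq_qPochNat_mul hq (q / y) n,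
    show q ^ (n + 1) / y = q / y * q ^ n by ring]
  field_simp

lemma qPochInf_mul_qPoch_negSucc_div {q : ℂ} (hq : ‖q‖ < 1) (hq0 : q ≠ 0) {x y : ℂ}
    (hx0 : x ≠ 0) (hy0 : y ≠ 0) (hx : ∀ n : ℕ, x ≠ q ^ (n + 1)) (n : ℕ) :
    qPochInf q (q / x) * qPochInf q (q / y) *
        (qPoch q x (Int.negSucc n) / qPoch q (q / y) (Int.negSucc n)) =
      (q / (x * y)) ^ (n + 1) *
        (qPochInf q (q / y) * qPochNat q y (n + 1) * qPochInf q (q ^ (n + 1 + 1) / x)) := by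
  have h3 : qPochNat q (q / x) (n + 1) ≠ 0 := by
    refine prod_ne_zero_iff.2 fun i _ => sub_ne_zero.2 fun h => hx i ?_
    field_simp at h
    rw [h]; ring
  have h4 : ∏ i ∈ range (n + 1), -(q ^ (i + 1))⁻¹ ≠ 0 :=
    prod_ne_zero_iff.2 fun i _ => neg_ne_zero.2 (inv_ne_zero (pow_ne_zero _ hq0))
  have h5 : q / (q / y) = y := by field_simp
  rw [qPoch, qPoch, prod_one_sub_mul_inv_pow hq0 hx0,
    prod_one_sub_mul_inv_pow hq0 (div_ne_zero hq0 hy0), h5,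
    qPochInf_eq_qPochNat_mul hq (q / x) (n + 1),
    show q ^ (n + 1 + 1) / x = q / x * q ^ (n + 1) by ring, div_pow, div_pow, mul_pow]
  generalize ∏ i ∈ range (n + 1), -(q ^ (i + 1))⁻¹ = E at *
  field_simp

/-- At index `-(n+1)`, reversing the factorials produces `∏ⱼ (q/(xⱼyⱼ))^(n+1)`. By the balancing
condition this is `q^(2(n+1))`, which with `z = q` leaves `q^(n+1)`. So the negative half has the
same shape with `x` and `y` exchanged. -/
lemma hasSum_prod_mul_psiTerm {q : ℂ} (hq : ‖q‖ < 1) (hq0 : q ≠ 0) {x y : Fin 3 → ℂ}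
    (hxy : (∏ j, x j) * (∏ j, y j) = q)
    (hx : ∀ j, ∀ n : ℕ, x j ≠ q ^ (n + 1)) (hy : ∀ j, ∀ n : ℕ, q / y j * q ^ n ≠ 1) :
    HasSum (fun k : ℤ => (∏ j, qPochInf q (q / x j) * qPochInf q (q / y j)) *
      psiTerm q x (fun j => q / y j) q k) (saalSeries q x y) := by
  have hx0 : ∀ j, x j ≠ 0 := fun j h => hq0 <| by
    rw [← hxy, prod_eq_zero (mem_univ j) h, zero_mul]
  have hy0 : ∀ j, y j ≠ 0 := fun j h => hq0 <| by
    rw [← hxy, prod_eq_zero (mem_univ j) h, mul_zero]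
  refine HasSum.of_nat_of_neg_add_one ?_ ?_
  · refine HasSum.congr_fun (summable_saalTerm hq x y).hasSum fun k => ?_
    rw [psiTerm, saalTerm, ← prod_div_distrib, ← mul_assoc, ← prod_mul_distrib, zpow_natCast,
      mul_comm]
    congr 1
    exact prod_congr rfl fun j _ => qPochInf_mul_qPoch_natCast_div hq (hy j) k
  · refine HasSum.congr_fun ((summable_nat_add_iff 1).2 (summable_saalTerm hq y x)).hasSum fun k => ?_
    rw [← Int.negSucc_eq, psiTerm, saalTerm, ← prod_div_distrib, ← mul_assoc, ← prod_mul_distrib,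
      prod_congr rfl fun j _ =>
        qPochInf_mul_qPoch_negSucc_div hq hq0 (hx0 j) (hy0 j) (hx j) k, prod_mul_distrib,
      prod_pow, prod_div_distrib, prod_mul_distrib, hxy, zpow_negSucc, mul_right_comm]
    congr 1
    rw [prod_const, card_univ, Fintype.card_fin]
    field_simp
    ring

lemma summable_psiTerm {q : ℂ} (hq : ‖q‖ < 1) (hq0 : q ≠ 0) {x y : Fin 3 → ℂ}
    (hxy : (∏ j, x j) * (∏ j, y j) = q)
    (hx : ∀ j, ∀ n : ℕ, x j ≠ q ^ (n + 1)) (hy : ∀ j, ∀ n : ℕ, q / y j * q ^ n ≠ 1) :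
    Summable (psiTerm q x (fun j => q / y j) q) := by
  refine (summable_mul_left_iff (prod_ne_zero_iff.2 fun j _ => mul_ne_zero ?_ ?_)).1
    (hasSum_prod_mul_psiTerm hq hq0 hxy hx hy).summable
  · refine qPochInf_ne_zero hq fun n h => hx j n ?_
    have : x j ≠ 0 := by rintro h0; simp [h0] at h
    field_simp at h
    rw [← h]; ring
  · exact qPochInf_ne_zero hq (hy j)

lemma prod_mul_psi {q : ℂ} (hq : ‖q‖ < 1) (hq0 : q ≠ 0) {x y : Fin 3 → ℂ}
    (hxy : (∏ j, x j) * (∏ j, y j) = q)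
    (hx : ∀ j, ∀ n : ℕ, x j ≠ q ^ (n + 1)) (hy : ∀ j, ∀ n : ℕ, q / y j * q ^ n ≠ 1) :
    (∏ j, qPochInf q (q / x j) * qPochInf q (q / y j)) * psi q x (fun j => q / y j) q =
      saalSeries q x y := by
  rw [psi, ← tsum_mul_left]
  exact (hasSum_prod_mul_psiTerm hq hq0 hxy hx hy).tsum_eq

/-! ### Contiguity of the series by telescoping. -/

/-- The telescoping sequence behind the contiguity relation for `saalSeries`. -/
def saalAux (q : ℂ) (x y : Fin 3 → ℂ) (k : ℕ) : ℂ :=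
  ∏ j, (qPochInf q (q / x j) * qPochNat q (x j) k * qPochInf q (q ^ k / y j))

lemma tendsto_saalAux {q : ℂ} (hq : ‖q‖ < 1) (x y : Fin 3 → ℂ) :
    Filter.Tendsto (saalAux q x y) Filter.atTop (nhds (∏ j, theta q (x j))) := by
  refine tendsto_finsetProd _ fun j _ => ?_
  have h0 : qPochInf q 0 = 1 := by simp [qPochInf]
  have h1 : Filter.Tendsto (fun k : ℕ => q ^ k / y j) Filter.atTop (nhds 0) := by
    simpa using (tendsto_pow_atTop_nhds_zero_of_norm_lt_one hq).div_const (y j)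
  have h2 := ((continuous_qPochInf hq).tendsto 0).comp h1
  have h3 := ((tendsto_qPochNat hq (x j)).const_mul (qPochInf q (q / x j))).mul h2
  rw [h0, mul_one, mul_comm] at h3
  exact h3

lemma qPochInf_mul_qPochNat_shift {q : ℂ} (hq : ‖q‖ < 1) (hq0 : q ≠ 0) {x : ℂ} (hx : x ≠ 0)
    (k : ℕ) : qPochInf q (q / (q * x)) * qPochNat q (q * x) k =
      -x⁻¹ * (qPochInf q (q / x) * qPochNat q x k * (1 - x * q ^ k)) := by
  rw [show q / (q * x) = x⁻¹ by field_simp, qPochInf_eq_mul hq x⁻¹, mul_assoc _ (qPochNat q x k),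
    ← qPochNat_succ, qPochNat_succ', ← div_eq_mul_inv]
  field_simp
  ring

lemma qPochInf_pow_div {q : ℂ} (hq : ‖q‖ < 1) (y : ℂ) (k : ℕ) :
    qPochInf q (q ^ k / y) = (1 - q ^ k / y) * qPochInf q (q ^ (k + 1) / y) := by
  rw [qPochInf_eq_mul hq]
  ring_nf

lemma qPochInf_pow_succ_div_q_mul {q : ℂ} (hq : ‖q‖ < 1) (hq0 : q ≠ 0) (y : ℂ) (k : ℕ) :
    qPochInf q (q ^ (k + 1) / (q * y)) = (1 - q ^ k / y) * qPochInf q (q ^ (k + 1) / y) := by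
  rw [← qPochInf_pow_div hq, pow_succ', mul_div_mul_left _ _ hq0]

/-- On the right the constant terms cancel, and the cubic terms cancel by `hxy`, leaving `z` times a
linear polynomial. The left side is its Lagrange interpolation at `z = 1/x₁` and `z = 1/x₂`. -/
lemma prod_shift_identity {x₁ x₂ x₃ y₁ y₂ y₃ : ℂ} (hxy : x₁ * x₂ * x₃ * (y₁ * y₂ * y₃) = 1) (z : ℂ) :
    x₁ * ((1 - 1 / (x₁ * y₁)) * (1 - 1 / (x₁ * y₂)) * (1 - 1 / (x₁ * y₃))) *
        (z * (-x₂⁻¹ * (1 - x₂ * z))) -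
      x₂ * ((1 - 1 / (x₂ * y₁)) * (1 - 1 / (x₂ * y₂)) * (1 - 1 / (x₂ * y₃))) *
        (z * (-x₁⁻¹ * (1 - x₁ * z))) =
      (x₁ - x₂) / (x₁ * x₂) * ((1 - x₁ * z) * (1 - x₂ * z) * (1 - x₃ * z) -
        (1 - z / y₁) * (1 - z / y₂) * (1 - z / y₃)) := by
  have h : x₁ ≠ 0 ∧ x₂ ≠ 0 ∧ x₃ ≠ 0 ∧ y₁ ≠ 0 ∧ y₂ ≠ 0 ∧ y₃ ≠ 0 := by
    refine ⟨?_, ?_, ?_, ?_, ?_, ?_⟩ <;> (rintro rfl; simp at hxy)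
  obtain ⟨h1, h2, h3, h4, h5, h6⟩ := h
  obtain rfl : x₃ = 1 / (x₁ * x₂ * (y₁ * y₂ * y₃)) := by
    field_simp
    linear_combination hxy
  field_simp
  ring

/-- The same interpolation for the negative half, now with nodes `w = x₁` and `w = x₂`. -/
lemma prod_shift_identity_inv {x₁ x₂ x₃ y₁ y₂ y₃ : ℂ} (hxy : x₁ * x₂ * x₃ * (y₁ * y₂ * y₃) = 1)
    (w : ℂ) :
    x₁ * ((1 - 1 / (x₁ * y₁)) * (1 - 1 / (x₁ * y₂)) * (1 - 1 / (x₁ * y₃))) *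
        (w * (1 - w / x₂)) -
      x₂ * ((1 - 1 / (x₂ * y₁)) * (1 - 1 / (x₂ * y₂)) * (1 - 1 / (x₂ * y₃))) *
        (w * (1 - w / x₁)) =
      (x₁ - x₂) / (x₁ * x₂) * (-y₁⁻¹ * -y₂⁻¹ * -y₃⁻¹ * ((1 - w / x₁) * (1 - w / x₂) * (1 - w / x₃) -
        (1 - y₁ * w) * (1 - y₂ * w) * (1 - y₃ * w))) := by
  have h : x₁ ≠ 0 ∧ x₂ ≠ 0 ∧ x₃ ≠ 0 ∧ y₁ ≠ 0 ∧ y₂ ≠ 0 ∧ y₃ ≠ 0 := by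
    refine ⟨?_, ?_, ?_, ?_, ?_, ?_⟩ <;> (rintro rfl; simp at hxy)
  obtain ⟨h1, h2, h3, h4, h5, h6⟩ := h
  obtain rfl : x₃ = 1 / (x₁ * x₂ * (y₁ * y₂ * y₃)) := by
    field_simp
    linear_combination hxy
  field_simp
  ring

lemma saalTerm_contiguity {q : ℂ} (hq : ‖q‖ < 1) (hq0 : q ≠ 0) {x y : Fin 3 → ℂ}
    (hx : ∀ j, x j ≠ 0) (hxy : (∏ j, x j) * (∏ j, y j) = 1) (k : ℕ) :
    x 0 * (∏ j, (1 - 1 / (x 0 * y j))) * saalTerm q ![x 0, q * x 1, x 2] y k -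
      x 1 * (∏ j, (1 - 1 / (x 1 * y j))) * saalTerm q ![q * x 0, x 1, x 2] y k =
    (x 0 - x 1) / (x 0 * x 1) * (saalAux q x y (k + 1) - saalAux q x y k) := by
  have e0 := qPochInf_mul_qPochNat_shift hq hq0 (hx 0) k
  have e1 := qPochInf_mul_qPochNat_shift hq hq0 (hx 1) k
  simp only [Fin.prod_univ_three] at hxy
  have key := prod_shift_identity hxy (q ^ k)
  simp only [saalTerm, saalAux, Fin.prod_univ_three, Matrix.cons_val_zero, Matrix.cons_val_one,
    Matrix.cons_val, qPochInf_pow_div hq _ k, qPochNat_succ, e0, e1]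
  generalize qPochInf q (q ^ (k + 1) / y 0) = r0
  generalize qPochInf q (q ^ (k + 1) / y 1) = r1
  generalize qPochInf q (q ^ (k + 1) / y 2) = r2
  generalize qPochInf q (q / x 0) = p0
  generalize qPochInf q (q / x 1) = p1
  generalize qPochInf q (q / x 2) = p2
  generalize qPochNat q (x 0) k = s0
  generalize qPochNat q (x 1) k = s1
  generalize qPochNat q (x 2) k = s2
  linear_combination (p0 * s0 * r0 * (p1 * s1 * r1) * (p2 * s2 * r2)) * key

lemma saalTerm_contiguity_neg {q : ℂ} (hq : ‖q‖ < 1) (hq0 : q ≠ 0) {x y : Fin 3 → ℂ}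
    (hy : ∀ j, y j ≠ 0) (hxy : (∏ j, x j) * (∏ j, y j) = 1) (k : ℕ) :
    x 0 * (∏ j, (1 - 1 / (x 0 * y j))) * saalTerm q y ![x 0, q * x 1, x 2] (k + 1) -
      x 1 * (∏ j, (1 - 1 / (x 1 * y j))) * saalTerm q y ![q * x 0, x 1, x 2] (k + 1) =
    (x 0 - x 1) / (x 0 * x 1) * (saalAux q (fun j => q * y j) (fun j => x j / q) k -
      saalAux q (fun j => q * y j) (fun j => x j / q) (k + 1)) := by
  have hs : ∀ j, qPochNat q (y j) k * (1 - y j * q ^ k) = qPochNat q (y j) (k + 1) :=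
    fun j => (qPochNat_succ _ _ _).symm
  have e : ∀ j, qPochInf q (q / (q * y j)) * qPochNat q (q * y j) k =
      -(y j)⁻¹ * (qPochInf q (q / y j) * qPochNat q (y j) (k + 1)) := fun j => by
    rw [qPochInf_mul_qPochNat_shift hq hq0 (hy j), mul_assoc _ (qPochNat _ _ _), hs]
  have e' : ∀ j, qPochInf q (q / (q * y j)) * qPochNat q (q * y j) (k + 1) =
      -(y j)⁻¹ * (qPochInf q (q / y j) * qPochNat q (y j) (k + 1) * (1 - y j * q ^ (k + 1))) :=
    fun j => qPochInf_mul_qPochNat_shift hq hq0 (hy j) (k + 1)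
  have g' : ∀ j (m : ℕ), q ^ m / (x j / q) = q ^ (m + 1) / x j := fun j m => by
    rw [div_div_eq_mul_div, pow_succ]
  simp only [Fin.prod_univ_three] at hxy
  have key := prod_shift_identity_inv hxy (q ^ (k + 1))
  simp only [saalTerm, saalAux, Fin.prod_univ_three, Matrix.cons_val_zero, Matrix.cons_val_one,
    Matrix.cons_val, e, e', g', qPochInf_pow_succ_div_q_mul hq hq0 _ (k + 1)]
  simp only [qPochInf_pow_div hq _ (k + 1)]
  generalize qPochInf q (q ^ (k + 1 + 1) / x 0) = r0
  generalize qPochInf q (q ^ (k + 1 + 1) / x 1) = r1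
  generalize qPochInf q (q ^ (k + 1 + 1) / x 2) = r2
  generalize qPochInf q (q / y 0) = p0
  generalize qPochInf q (q / y 1) = p1
  generalize qPochInf q (q / y 2) = p2
  generalize qPochNat q (y 0) (k + 1) = s0
  generalize qPochNat q (y 1) (k + 1) = s1
  generalize qPochNat q (y 2) (k + 1) = s2
  linear_combination (p0 * s0 * r0 * (p1 * s1 * r1) * (p2 * s2 * r2)) * key

lemma tsum_eq_of_telescoping {f g : ℕ → ℂ} (hf : Summable f) (h : ∀ k, f k = g (k + 1) - g k)
    {l : ℂ} (hg : Filter.Tendsto g Filter.atTop (nhds l)) : ∑' k, f k = l - g 0 := by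
  refine tendsto_nhds_unique hf.hasSum.tendsto_sum_nat ?_
  simp only [h, sum_range_sub]
  exact hg.sub_const _

/-- Both halves telescope; the limits at the two ends give the two theta products. The parameters
multiply to 1 here so that each shifted series is balanced. -/
lemma saalSeries_contiguity {q : ℂ} (hq : ‖q‖ < 1) (hq0 : q ≠ 0) {x y : Fin 3 → ℂ}
    (hxy : (∏ j, x j) * (∏ j, y j) = 1) :
    x 0 * (∏ j, (1 - 1 / (x 0 * y j))) * saalSeries q ![x 0, q * x 1, x 2] y -
      x 1 * (∏ j, (1 - 1 / (x 1 * y j))) * saalSeries q ![q * x 0, x 1, x 2] y =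
    (x 0 - x 1) / (x 0 * x 1) * (∏ j, theta q (x j) + (∏ j, y j)⁻¹ * ∏ j, theta q (y j)) := by
  have hx : ∀ j, x j ≠ 0 := fun j h => by
    simp [prod_eq_zero (mem_univ j) h] at hxy
  have hy : ∀ j, y j ≠ 0 := fun j h => by
    simp [prod_eq_zero (mem_univ j) h] at hxy
  set A := x 0 * ∏ j, (1 - 1 / (x 0 * y j))
  set B := x 1 * ∏ j, (1 - 1 / (x 1 * y j))
  set c := (x 0 - x 1) / (x 0 * x 1)
  have s1 := (summable_saalTerm hq ![x 0, q * x 1, x 2] y).mul_left A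
  have s2 := (summable_saalTerm hq ![q * x 0, x 1, x 2] y).mul_left B
  have s3 := ((summable_nat_add_iff 1).2 (summable_saalTerm hq y ![x 0, q * x 1, x 2])).mul_left A
  have s4 := ((summable_nat_add_iff 1).2 (summable_saalTerm hq y ![q * x 0, x 1, x 2])).mul_left B
  have t1 := tsum_eq_of_telescoping (s1.sub s2)
    (g := fun k => c * saalAux q x y k)
    (fun k => by rw [saalTerm_contiguity hq hq0 hx hxy k, mul_sub])
    ((tendsto_saalAux hq x y).const_mul c)
  have t2 := tsum_eq_of_telescoping (s3.sub s4)
    (g := fun k => -c * saalAux q (fun j => q * y j) (fun j => x j / q) k)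
    (fun k => by rw [saalTerm_contiguity_neg hq hq0 hy hxy k]; ring)
    ((tendsto_saalAux hq _ _).const_mul (-c))
  rw [s1.tsum_sub s2, tsum_mul_left, tsum_mul_left] at t1
  rw [s3.tsum_sub s4, tsum_mul_left, tsum_mul_left] at t2
  -- The inner boundary terms of the two halves agree, so they cancel.
  have h0 : saalAux q x y 0 = saalAux q (fun j => q * y j) (fun j => x j / q) 0 := by
    refine prod_congr rfl fun j _ => ?_
    have e1 : q / (q * y j) = 1 / y j := by have := hy j; field_simp
    have e2 : 1 / (x j / q) = q / x j := by rw [one_div_div]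
    simp only [pow_zero, qPochNat_zero, mul_one, e1, e2]
    ring
  have h1 : ∏ j, theta q (q * y j) = -((∏ j, y j)⁻¹ * ∏ j, theta q (y j)) := by
    rw [prod_congr rfl fun j _ => theta_q_mul hq hq0 (hy j)]
    simp only [Fin.prod_univ_three, mul_inv]
    ring
  rw [h1] at t2
  rw [saalSeries, saalSeries]
  linear_combination t1 + t2 - c * h0

/-! ### Contiguity of the determinant. -/

/-- The determinant of the theorem, with `f₃` replaced by `saalSeries`. -/
def saalDet (q : ℂ) (a b lam : Fin 3 → ℂ) : ℂ :=
  Matrix.det (Matrix.of fun i j : Fin 3 => (![f₁ q b (lam i), f₂ q a (lam i),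
    saalSeries q (fun k => a k * lam i) (fun k => b k / lam i)] : Fin 3 → ℂ) j)

/-- The product `∏ⱼ (q/(x bⱼ))_∞`. -/
def phi (q : ℂ) (b : Fin 3 → ℂ) (x : ℂ) : ℂ := ∏ j, qPochInf q (q / (x * b j))

lemma phi_q_mul {q : ℂ} (hq : ‖q‖ < 1) (hq0 : q ≠ 0) (b : Fin 3 → ℂ) (x : ℂ) :
    phi q b (q * x) = (∏ j, (1 - 1 / (x * b j))) * phi q b x := by
  rw [phi, phi, ← prod_mul_distrib]
  refine prod_congr rfl fun j _ => ?_
  rw [mul_assoc, ← div_div, div_self hq0, qPochInf_eq_mul hq, mul_one_div]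

/-- The coefficients do not depend on `l`, so this is a relation between columns of the matrix. -/
lemma saalSeries_contiguity_row {q : ℂ} (hq : ‖q‖ < 1) (hq0 : q ≠ 0) {a b : Fin 3 → ℂ}
    (hab : (∏ j, a j) * (∏ j, b j) = 1) {l : ℂ} (hl : l ≠ 0) :
    a 0 * (∏ j, (1 - 1 / (a 0 * b j))) *
        saalSeries q (fun k => ![a 0, q * a 1, a 2] k * l) (fun k => b k / l) -
      a 1 * (∏ j, (1 - 1 / (a 1 * b j))) *
        saalSeries q (fun k => ![q * a 0, a 1, a 2] k * l) (fun k => b k / l) =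
    (a 0 - a 1) / (a 0 * a 1) * (l⁻¹ ^ 2 * ∏ j, theta q (a j * l)) +
      (a 0 - a 1) / (a 0 * a 1) * (∏ j, b j)⁻¹ * f₁ q b l := by
  have hxy : (∏ j, a j * l) * (∏ j, b j / l) = 1 := by
    rw [prod_mul_distrib, prod_div_distrib, prod_const]
    field_simp
    exact hab
  have ha : ∀ j, a j ≠ 0 := fun j h => by
    simp [prod_eq_zero (mem_univ j) h] at hab
  have hb : ∀ j, b j ≠ 0 := fun j h => by
    simp [prod_eq_zero (mem_univ j) h] at hab
  have key := saalSeries_contiguity hq hq0 hxy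
  have e1 : (fun k => ![a 0, q * a 1, a 2] k * l) = ![a 0 * l, q * (a 1 * l), a 2 * l] := by
    ext k; fin_cases k <;> simp [mul_assoc]
  have e2 : (fun k => ![q * a 0, a 1, a 2] k * l) = ![q * (a 0 * l), a 1 * l, a 2 * l] := by
    ext k; fin_cases k <;> simp [mul_assoc]
  have e3 : ∀ i j, a i * l * (b j / l) = a i * b j := fun i j => by field_simp
  rw [e1, e2, f₁]
  simp only [e3] at key
  rw [prod_div_distrib, prod_const, card_univ, Fintype.card_fin] at key
  have ha0 := ha 0
  have ha1 := ha 1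
  have hB : ∏ j, b j ≠ 0 := prod_ne_zero_iff.2 fun j _ => hb j
  refine mul_left_cancel₀ hl (Eq.trans ?_ (key.trans ?_))
  · ring
  · generalize ∏ j, theta q (a j * l) = P
    generalize ∏ j, theta q (b j / l) = Q
    field_simp

lemma f₂_shift_one {q : ℂ} (hq : ‖q‖ < 1) (hq0 : q ≠ 0) {a : Fin 3 → ℂ}
    (h : a 1 ≠ 0) {l : ℂ} (hl : l ≠ 0) :
    f₂ q ![a 0, q * a 1, a 2] l = -(a 1)⁻¹ * (l⁻¹ ^ 2 * ∏ j, theta q (a j * l)) := by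
  simp only [f₂, Fin.prod_univ_three, Matrix.cons_val_zero, Matrix.cons_val_one, Matrix.cons_val]
  rw [mul_assoc q, theta_q_mul hq hq0 (mul_ne_zero h hl)]
  field_simp

lemma f₂_shift_zero {q : ℂ} (hq : ‖q‖ < 1) (hq0 : q ≠ 0) {a : Fin 3 → ℂ}
    (h : a 0 ≠ 0) {l : ℂ} (hl : l ≠ 0) :
    f₂ q ![q * a 0, a 1, a 2] l = -(a 0)⁻¹ * (l⁻¹ ^ 2 * ∏ j, theta q (a j * l)) := by
  simp only [f₂, Fin.prod_univ_three, Matrix.cons_val_zero, Matrix.cons_val_one, Matrix.cons_val]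
  rw [mul_assoc q, theta_q_mul hq hq0 (mul_ne_zero h hl)]
  field_simp

/-- Both shifts of `f₂` are multiples of the same function `l⁻² ∏ⱼ θ(aⱼl)`. Together with `f₁` it
spans the inhomogeneous part of the contiguity relation, which therefore drops out of the
determinant. -/
lemma saalDet_contiguity {q : ℂ} (hq : ‖q‖ < 1) (hq0 : q ≠ 0) {a b lam : Fin 3 → ℂ}
    (hab : (∏ j, a j) * (∏ j, b j) = 1) (hl : ∀ i, lam i ≠ 0) :
    (∏ j, (1 - 1 / (a 0 * b j))) * saalDet q ![a 0, q * a 1, a 2] b lam =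
      (∏ j, (1 - 1 / (a 1 * b j))) * saalDet q ![q * a 0, a 1, a 2] b lam := by
  have ha : ∀ j, a j ≠ 0 := fun j h => by
    simp [prod_eq_zero (mem_univ j) h] at hab
  have ha0 := ha 0
  have ha1 := ha 1
  have r := fun i => saalSeries_contiguity_row hq hq0 hab (hl i)
  simp only [saalDet, Matrix.det_fin_three, Matrix.of_apply, Matrix.cons_val_zero,
    Matrix.cons_val_one, Matrix.cons_val, f₂_shift_one hq hq0 ha1 (hl _),
    f₂_shift_zero hq hq0 ha0 (hl _)]
  have r0 := r 0
  have r1 := r 1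
  have r2 := r 2
  set A := ∏ j, (1 - 1 / (a 0 * b j))
  set B := ∏ j, (1 - 1 / (a 1 * b j))
  generalize (∏ j, b j)⁻¹ = β at *
  generalize (a 0 - a 1) / (a 0 * a 1) = α at *
  generalize (lam 0)⁻¹ ^ 2 * ∏ j, theta q (a j * lam 0) = p0 at *
  generalize (lam 1)⁻¹ ^ 2 * ∏ j, theta q (a j * lam 1) = p1 at *
  generalize (lam 2)⁻¹ ^ 2 * ∏ j, theta q (a j * lam 2) = p2 at *
  generalize f₁ q b (lam 0) = u0 at *
  generalize f₁ q b (lam 1) = u1 at *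
  generalize f₁ q b (lam 2) = u2 at *
  generalize saalSeries q (fun k => ![a 0, q * a 1, a 2] k * lam 0) _ = F0 at *
  generalize saalSeries q (fun k => ![a 0, q * a 1, a 2] k * lam 1) _ = F1 at *
  generalize saalSeries q (fun k => ![a 0, q * a 1, a 2] k * lam 2) _ = F2 at *
  generalize saalSeries q (fun k => ![q * a 0, a 1, a 2] k * lam 0) _ = G0 at *
  generalize saalSeries q (fun k => ![q * a 0, a 1, a 2] k * lam 1) _ = G1 at *
  generalize saalSeries q (fun k => ![q * a 0, a 1, a 2] k * lam 2) _ = G2 at *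
  refine mul_left_cancel₀ (mul_ne_zero ha0 ha1) ?_
  have i0 : a 0 * (a 0)⁻¹ = 1 := mul_inv_cancel₀ ha0
  have i1 : a 1 * (a 1)⁻¹ = 1 := mul_inv_cancel₀ ha1
  generalize (a 0)⁻¹ = j0 at *
  generalize (a 1)⁻¹ = j1 at *
  -- The multipliers of the row relations are the cofactors along the third column.
  linear_combination -(u1 * p2 - u2 * p1) * r0 - (u2 * p0 - u0 * p2) * r1
    - (u0 * p1 - u1 * p0) * r2
    - a 0 * A * (F0 * (u1 * p2 - u2 * p1) + F1 * (u2 * p0 - u0 * p2)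
      + F2 * (u0 * p1 - u1 * p0)) * i1
    + a 1 * B * (G0 * (u1 * p2 - u2 * p1) + G1 * (u2 * p0 - u0 * p2)
      + G2 * (u0 * p1 - u1 * p0)) * i0

/-! ### Holomorphy of the determinant, and rigidity of `q`-periodic quotients. -/

lemma DifferentiableOn.phi {q : ℂ} (hq : ‖q‖ < 1) {b : Fin 3 → ℂ} (hb : ∀ j, b j ≠ 0) {U : Set ℂ}
    {x : ℂ → ℂ} (hx : DifferentiableOn ℂ x U) (h0 : ∀ s ∈ U, x s ≠ 0) :
    DifferentiableOn ℂ (fun s => phi q b (x s)) U :=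
  DifferentiableOn.fun_finsetProd fun j _ => DifferentiableOn.qPochInf hq
    ((differentiableOn_const q).div (hx.mul_const _) fun s hs => mul_ne_zero (h0 s hs) (hb j))

lemma DifferentiableOn.saalDet {q : ℂ} (hq : ‖q‖ < 1) {U : Set ℂ} (hU : IsOpen U)
    {a b lam : ℂ → Fin 3 → ℂ}
    (ha : ∀ j, DifferentiableOn ℂ (fun s => a s j) U)
    (hb : ∀ j, DifferentiableOn ℂ (fun s => b s j) U)
    (hl : ∀ j, DifferentiableOn ℂ (fun s => lam s j) U)
    (ha0 : ∀ j, ∀ s ∈ U, a s j ≠ 0) (hb0 : ∀ j, ∀ s ∈ U, b s j ≠ 0)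
    (hl0 : ∀ j, ∀ s ∈ U, lam s j ≠ 0) :
    DifferentiableOn ℂ (fun s => saalDet q (a s) (b s) (lam s)) U := by
  have h1 : ∀ i, DifferentiableOn ℂ (fun s => f₁ q (b s) (lam s i)) U := fun i =>
    (hl i).mul (DifferentiableOn.fun_finsetProd fun j _ =>
      DifferentiableOn.theta hq ((hb j).div (hl i) (hl0 i))
        fun s hs => div_ne_zero (hb0 j s hs) (hl0 i s hs))
  have h2 : ∀ i, DifferentiableOn ℂ (fun s => f₂ q (a s) (lam s i)) U := fun i =>
    ((hl i).inv (hl0 i)).mul (DifferentiableOn.fun_finsetProd fun j _ =>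
      DifferentiableOn.theta hq ((ha j).mul (hl i))
        fun s hs => mul_ne_zero (ha0 j s hs) (hl0 i s hs))
  have h3 : ∀ i, DifferentiableOn ℂ (fun s =>
      BilateralSaalschutz.saalSeries q (fun k => a s k * lam s i) (fun k => b s k / lam s i)) U :=
    fun i => DifferentiableOn.saalSeries hq hU (fun j => (ha j).mul (hl i))
      (fun j => (hb j).div (hl i) (hl0 i)) (fun j s hs => mul_ne_zero (ha0 j s hs) (hl0 i s hs))
      fun j s hs => div_ne_zero (hb0 j s hs) (hl0 i s hs)
  simp only [BilateralSaalschutz.saalDet, Matrix.det_fin_three, Matrix.of_apply,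
    Matrix.cons_val_zero, Matrix.cons_val_one, Matrix.cons_val]
  have h10 := h1 0
  have h11 := h1 1
  have h12 := h1 2
  have h20 := h2 0
  have h21 := h2 1
  have h22 := h2 2
  have h30 := h3 0
  have h31 := h3 1
  have h32 := h3 2
  fun_prop

lemma isPreconnected_annulus {r₁ r₂ : ℝ} (h₁ : 0 < r₁) (h₂ : 0 < r₂) :
    IsPreconnected {s : ℂ | r₁ < ‖s‖ ∧ ‖s‖ < r₂} := by
  have h : {s : ℂ | r₁ < ‖s‖ ∧ ‖s‖ < r₂} =
      Complex.exp '' (Complex.re ⁻¹' Set.Ioo (Real.log r₁) (Real.log r₂)) := by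
    ext s
    constructor
    · rintro ⟨hs1, hs2⟩
      have hs : 0 < ‖s‖ := h₁.trans hs1
      refine ⟨Complex.log s, ?_, Complex.exp_log (norm_pos_iff.1 hs)⟩
      rw [Set.mem_preimage, Complex.log_re]
      exact ⟨Real.log_lt_log h₁ hs1, Real.log_lt_log hs hs2⟩
    · rintro ⟨z, ⟨hz1, hz2⟩, rfl⟩
      rw [Set.mem_ofPred_eq, Complex.norm_exp]
      exact ⟨(Real.log_lt_iff_lt_exp h₁).1 hz1, (Real.lt_log_iff_exp_lt h₂).1 hz2⟩
  rw [h]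
  refine IsPreconnected.image ?_ _ Complex.continuous_exp.continuousOn
  exact ((convex_Ioo _ _).linear_preimage Complex.reLm).isPreconnected

lemma eqOn_compl_zero_of_eventuallyEq {f g : ℂ → ℂ} (hf : DifferentiableOn ℂ f {0}ᶜ)
    (hg : DifferentiableOn ℂ g {0}ᶜ) {u : ℂ} (hu : u ≠ 0) (h : f =ᶠ[nhds u] g) {s : ℂ}
    (hs : s ≠ 0) : f s = g s := by
  refine (hf.analyticOnNhd isOpen_compl_singleton).eqOn_of_preconnected_of_eventuallyEq
    (hg.analyticOnNhd isOpen_compl_singleton) ?_ hu h hs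
  refine (isConnected_compl_singleton_of_one_lt_rank ?_ 0).isPreconnected
  simp

/-- A quotient `D / P` of holomorphic functions on `ℂ \ {0}` that is invariant under `s ↦ q s` and
has no poles in an annulus containing a fundamental domain is constant. -/
lemma mul_eq_mul_of_q_periodic {q : ℂ} (hq : ‖q‖ < 1) (hq0 : q ≠ 0) {D P : ℂ → ℂ}
    (hD : DifferentiableOn ℂ D {0}ᶜ) (hP : DifferentiableOn ℂ P {0}ᶜ)
    (hP0 : ∀ s, ‖q‖ ^ 2 < ‖s‖ → ‖s‖ < ‖q‖⁻¹ → P s ≠ 0)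
    (hper : ∀ s, s ≠ 0 → D (q * s) * P s = D s * P (q * s)) {s : ℂ} (hs : s ≠ 0) :
    D s * P 1 = D 1 * P s := by
  have hqn : 0 < ‖q‖ := norm_pos_iff.2 hq0
  -- An open annulus around `‖q‖ ≤ ‖s‖ ≤ 1`, narrow enough that one multiplication or division by
  -- `q` brings each of its points into that compact set.
  set U : Set ℂ := {s : ℂ | ‖q‖ ^ 2 < ‖s‖ ∧ ‖s‖ < ‖q‖⁻¹} with hUdef
  have hUo : IsOpen U :=
    (isOpen_lt continuous_const continuous_norm).inter (isOpen_lt continuous_norm continuous_const)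
  have hU0 : U ⊆ {0}ᶜ := fun s hs h => by
    rw [Set.mem_singleton_iff] at h
    have := hs.1
    rw [h, norm_zero] at this
    exact absurd this (not_lt.2 (by positivity))
  have hq2 : ‖q‖ ^ 2 < ‖q‖ := by nlinarith
  have hqi : 1 < ‖q‖⁻¹ := (one_lt_inv₀ hqn).2 hq
  have h1U : (1 : ℂ) ∈ U := by
    simp only [hUdef, Set.mem_ofPred_eq, norm_one]
    exact ⟨by linarith, hqi⟩
  have hR : DifferentiableOn ℂ (fun s => D s / P s) U :=
    (hD.mono hU0).div (hP.mono hU0) fun s hs => hP0 s hs.1 hs.2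
  have hRper : ∀ s, s ∈ U → q * s ∈ U → D (q * s) / P (q * s) = D s / P s := fun s hs hs' => by
    rw [div_eq_div_iff (hP0 _ hs'.1 hs'.2) (hP0 _ hs.1 hs.2)]
    exact hper s (hU0 hs)
  set K : Set ℂ := Metric.closedBall 0 1 ∩ {s | ‖q‖ ≤ ‖s‖}
  have hK : IsCompact K := (isCompact_closedBall _ _).inter_right
    (isClosed_le continuous_const continuous_norm)
  have hmemK : ∀ s, s ∈ K ↔ ‖s‖ ≤ 1 ∧ ‖q‖ ≤ ‖s‖ := fun s => by
    simp [K]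
  have hKU : K ⊆ U := fun s hs => by
    rw [hmemK] at hs
    exact ⟨by linarith [hs.2], by linarith [hs.1]⟩
  obtain ⟨c, hcK, hc⟩ := hK.exists_isMaxOn ⟨1, (hmemK 1).2 (by simpa using hq.le)⟩
    ((hR.mono hKU).continuousOn.norm)
  have hmax : IsMaxOn (norm ∘ fun s => D s / P s) U c := by
    intro s hs
    change ‖D s / P s‖ ≤ ‖D c / P c‖
    rcases le_or_gt ‖s‖ 1 with h1 | h1
    · rcases le_or_gt ‖q‖ ‖s‖ with h2 | h2
      · exact hc ((hmemK s).2 ⟨h1, h2⟩)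
      · have hqs : q * (s / q) = s := by field_simp
        have hK' : s / q ∈ K := by
          rw [hmemK, norm_div, div_le_one hqn, le_div_iff₀ hqn, ← pow_two]
          exact ⟨h2.le, hs.1.le⟩
        have := hRper (s / q) (hKU hK') (by rwa [hqs])
        rw [hqs] at this
        rw [this]
        exact hc hK'
    · have hK' : q * s ∈ K := by
        rw [hmemK, norm_mul]
        refine ⟨?_, le_mul_of_one_le_right hqn.le h1.le⟩
        rw [← mul_inv_cancel₀ hqn.ne']
        exact mul_le_mul_of_nonneg_left hs.2.le hqn.le
      rw [← hRper s hs (hKU hK')]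
      exact hc hK'
  have hconst := Complex.eqOn_of_isPreconnected_of_isMaxOn_norm
    (isPreconnected_annulus (pow_pos hqn 2) (inv_pos.2 hqn)) hUo hR (hKU hcK) hmax
  refine eqOn_compl_zero_of_eventuallyEq (f := fun s => D s * P 1) (g := fun s => D 1 * P s)
    (hD.mul_const _) (hP.const_mul _) one_ne_zero ?_ hs
  filter_upwards [hUo.mem_nhds h1U] with r hr
  have h := (hconst hr).trans (hconst h1U).symm
  rwa [div_eq_div_iff (hP0 _ hr.1 hr.2) (hP0 _ h1U.1 h1U.2)] at h

/-! ### Moving the parameters at fixed product. -/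

lemma saalDet_q_periodic {q : ℂ} (hq : ‖q‖ < 1) (hq0 : q ≠ 0) {a₀ a₁ a₂ : ℂ} {b lam : Fin 3 → ℂ}
    (hab : a₀ * a₁ * a₂ * (∏ j, b j) = q) (hl : ∀ i, lam i ≠ 0) {s : ℂ} (hs : s ≠ 0) :
    saalDet q ![a₀ * (q * s), a₁ / (q * s), a₂] b lam * (phi q b (a₀ * s) * phi q b (a₁ / s)) =
      saalDet q ![a₀ * s, a₁ / s, a₂] b lam *
        (phi q b (a₀ * (q * s)) * phi q b (a₁ / (q * s))) := by
  have h := saalDet_contiguity hq hq0 (a := ![a₀ * s, a₁ / (q * s), a₂]) (b := b) (lam := lam)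
    (by
      simp only [Fin.prod_univ_three, Matrix.cons_val_zero, Matrix.cons_val_one,
        Matrix.cons_val] at hab ⊢
      field_simp
      linear_combination hab) hl
  simp only [Matrix.cons_val_zero, Matrix.cons_val_one, Matrix.cons_val] at h
  have e1 : q * (a₁ / (q * s)) = a₁ / s := by field_simp
  have e2 : a₀ * (q * s) = q * (a₀ * s) := by ring
  have p1 := phi_q_mul hq hq0 b (a₁ / (q * s))
  have p2 := phi_q_mul hq hq0 b (a₀ * s)
  rw [e1] at h p1
  rw [e2, p1, p2]
  linear_combination -(phi q b (a₀ * s) * phi q b (a₁ / (q * s))) * h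

/-- The size conditions put every argument `q/(a₀sbⱼ)` and `qs/(a₁bⱼ)` inside the unit disc for `s`
in the annulus, so the denominator has no zero there. -/
lemma saalDet_move_of_large {q : ℂ} (hq : ‖q‖ < 1) (hq0 : q ≠ 0) {a₀ a₁ a₂ : ℂ}
    {b lam : Fin 3 → ℂ} (hab : a₀ * a₁ * a₂ * (∏ j, b j) = q) (hl : ∀ i, lam i ≠ 0)
    (h₀ : ∀ j, ‖q‖⁻¹ ≤ ‖a₀ * b j‖) (h₁ : ∀ j, 1 ≤ ‖a₁ * b j‖) {s : ℂ} (hs : s ≠ 0) :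
    saalDet q ![a₀ * s, a₁ / s, a₂] b lam * (phi q b a₀ * phi q b a₁) =
      saalDet q ![a₀, a₁, a₂] b lam * (phi q b (a₀ * s) * phi q b (a₁ / s)) := by
  have hqn : 0 < ‖q‖ := norm_pos_iff.2 hq0
  have ha0 : a₀ ≠ 0 := by rintro rfl; simp at hab; exact hq0 hab.symm
  have ha1 : a₁ ≠ 0 := by rintro rfl; simp at hab; exact hq0 hab.symm
  have ha2 : a₂ ≠ 0 := by rintro rfl; simp at hab; exact hq0 hab.symm
  have hb : ∀ j, b j ≠ 0 := fun j h => hq0 <| by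
    rw [← hab, prod_eq_zero (mem_univ j) h, mul_zero]
  have dx : DifferentiableOn ℂ (fun s => a₀ * s) {0}ᶜ := by fun_prop
  have dy : DifferentiableOn ℂ (fun s => a₁ / s) {0}ᶜ :=
    (differentiableOn_const _).div differentiableOn_id fun s hs => hs
  have nx : ∀ s ∈ ({0}ᶜ : Set ℂ), a₀ * s ≠ 0 := fun s hs => mul_ne_zero ha0 hs
  have ny : ∀ s ∈ ({0}ᶜ : Set ℂ), a₁ / s ≠ 0 := fun s hs => div_ne_zero ha1 hs
  have key := mul_eq_mul_of_q_periodic hq hq0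
    (D := fun s => saalDet q ![a₀ * s, a₁ / s, a₂] b lam)
    (P := fun s => phi q b (a₀ * s) * phi q b (a₁ / s)) ?_ ?_ ?_ ?_ hs
  · simpa using key
  · refine DifferentiableOn.saalDet hq isOpen_compl_singleton ?_ (fun j => differentiableOn_const _)
      (fun j => differentiableOn_const _) ?_ (fun j _ _ => hb j) (fun j _ _ => hl j)
    · intro j; fin_cases j
      exacts [dx, dy, differentiableOn_const _]
    · intro j; fin_cases j
      exacts [nx, ny, fun _ _ => ha2]
  · exact (DifferentiableOn.phi hq hb dx nx).mul (DifferentiableOn.phi hq hb dy ny)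
  · intro s hs1 hs2
    have hsn : 0 < ‖s‖ := (by positivity : (0 : ℝ) ≤ ‖q‖ ^ 2).trans_lt hs1
    refine mul_ne_zero (prod_ne_zero_iff.2 fun j _ => qPochInf_ne_zero_of_norm_lt_one hq ?_)
      (prod_ne_zero_iff.2 fun j _ => qPochInf_ne_zero_of_norm_lt_one hq ?_)
    · have h := h₀ j
      rw [inv_le_iff_one_le_mul₀ hqn] at h
      rw [mul_right_comm, norm_div, norm_mul, div_lt_one (by nlinarith)]
      nlinarith
    · have h := h₁ j
      have h3 : ‖q‖ * ‖s‖ < 1 := by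
        calc ‖q‖ * ‖s‖ < ‖q‖ * ‖q‖⁻¹ := by gcongr
          _ = 1 := mul_inv_cancel₀ hqn.ne'
      rw [show q / (a₁ / s * b j) = q * s / (a₁ * b j) by field_simp, norm_div, norm_mul,
        div_lt_one (by linarith)]
      linarith
  · exact fun s hs => saalDet_q_periodic hq hq0 hab hl hs

lemma saalDet_move {q : ℂ} (hq : ‖q‖ < 1) (hq0 : q ≠ 0) {a₀ a₁ a₂ : ℂ}
    {b lam : Fin 3 → ℂ} (hab : a₀ * a₁ * a₂ * (∏ j, b j) = q) (hl : ∀ i, lam i ≠ 0)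
    {s : ℂ} (hs : s ≠ 0) :
    saalDet q ![a₀ * s, a₁ / s, a₂] b lam * (phi q b a₀ * phi q b a₁) =
      saalDet q ![a₀, a₁, a₂] b lam * (phi q b (a₀ * s) * phi q b (a₁ / s)) := by
  have hqn : 0 < ‖q‖ := norm_pos_iff.2 hq0
  have ha0 : a₀ ≠ 0 := by rintro rfl; simp at hab; exact hq0 hab.symm
  have ha1 : a₁ ≠ 0 := by rintro rfl; simp at hab; exact hq0 hab.symm
  have ha2 : a₂ ≠ 0 := by rintro rfl; simp at hab; exact hq0 hab.symm
  have hb : ∀ j, b j ≠ 0 := fun j h => hq0 <| by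
    rw [← hab, prod_eq_zero (mem_univ j) h, mul_zero]
  have d : ∀ c : ℂ, DifferentiableOn ℂ (fun u => c * u) {0}ᶜ := fun c => by fun_prop
  have n : ∀ c : ℂ, c ≠ 0 → ∀ u ∈ ({0}ᶜ : Set ℂ), c * u ≠ 0 := fun c hc u hu => mul_ne_zero hc hu
  have dD : ∀ c₀ c₁ : ℂ, c₀ ≠ 0 → c₁ ≠ 0 →
      DifferentiableOn ℂ (fun u => saalDet q ![c₀ * u, c₁ * u, a₂ / u ^ 2] b lam) {0}ᶜ := by
    intro c₀ c₁ h0 h1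
    refine DifferentiableOn.saalDet hq isOpen_compl_singleton ?_ (fun j => differentiableOn_const _)
      (fun j => differentiableOn_const _) ?_ (fun j _ _ => hb j) (fun j _ _ => hl j)
    · intro j; fin_cases j
      exacts [d c₀, d c₁, (differentiableOn_const _).div (differentiableOn_id.pow 2)
        fun u hu => pow_ne_zero 2 hu]
    · intro j; fin_cases j
      exacts [n c₀ h0, n c₁ h1, fun u hu => div_ne_zero ha2 (pow_ne_zero 2 hu)]
  have dP : ∀ c₀ c₁ : ℂ, c₀ ≠ 0 → c₁ ≠ 0 →
      DifferentiableOn ℂ (fun u => phi q b (c₀ * u) * phi q b (c₁ * u)) {0}ᶜ := fun c₀ c₁ h0 h1 =>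
    (DifferentiableOn.phi hq hb (d c₀) (n c₀ h0)).mul (DifferentiableOn.phi hq hb (d c₁) (n c₁ h1))
  have hlim : ∀ c : ℂ, c ≠ 0 → ∀ r : ℝ, ∀ᶠ u in Filter.comap norm Filter.atTop, ∀ j,
      r < ‖c * u * b j‖ := by
    intro c hc r
    refine Filter.eventually_all.2 fun j => ?_
    filter_upwards [Filter.tendsto_comap.eventually_gt_atTop (r / (‖c‖ * ‖b j‖))] with u hu
    have : 0 < ‖c‖ * ‖b j‖ := mul_pos (norm_pos_iff.2 hc) (norm_pos_iff.2 (hb j))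
    rw [div_lt_iff₀ this] at hu
    rw [norm_mul, norm_mul]
    linarith
  obtain ⟨C, hC⟩ : ∃ C : ℝ, ∀ u : ℂ, C < ‖u‖ → u ≠ 0 ∧ ∀ j,
      ‖q‖⁻¹ ≤ ‖a₀ * u * b j‖ ∧ 1 ≤ ‖a₁ * u * b j‖ := by
    have h := ((hlim a₀ ha0 ‖q‖⁻¹).and (hlim a₁ ha1 1)).and
      (Filter.tendsto_comap.eventually_gt_atTop (f := (norm : ℂ → ℝ)) 0)
    rw [Filter.eventually_comap] at h
    obtain ⟨C, hC⟩ := Filter.eventually_atTop.1 h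
    refine ⟨C, fun u hu => ?_⟩
    obtain ⟨⟨h1, h2⟩, h3⟩ := hC ‖u‖ hu.le u rfl
    exact ⟨norm_pos_iff.1 h3, fun j => ⟨(h1 j).le, (h2 j).le⟩⟩
  obtain ⟨u₀, hu₀⟩ : ∃ u₀ : ℂ, C < ‖u₀‖ := NormedField.exists_lt_norm ℂ C
  -- Scaling to `(a₀u, a₁u, a₂/u²)` preserves the product and makes the first two parameters large.
  -- The cross-multiplied identity holds near `u₀` and is continued to `u = 1`.
  have key := eqOn_compl_zero_of_eventuallyEq
    (f := fun u => saalDet q ![a₀ * s * u, a₁ / s * u, a₂ / u ^ 2] b lam *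
      (phi q b (a₀ * u) * phi q b (a₁ * u)))
    (g := fun u => saalDet q ![a₀ * u, a₁ * u, a₂ / u ^ 2] b lam *
      (phi q b (a₀ * s * u) * phi q b (a₁ / s * u)))
    ((dD _ _ (mul_ne_zero ha0 hs) (div_ne_zero ha1 hs)).mul (dP _ _ ha0 ha1))
    ((dD _ _ ha0 ha1).mul (dP _ _ (mul_ne_zero ha0 hs) (div_ne_zero ha1 hs)))
    (hC u₀ hu₀).1 ?_ (one_ne_zero)
  · simpa using key
  · filter_upwards [(isOpen_lt continuous_const continuous_norm).mem_nhds hu₀] with u hu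
    obtain ⟨hu0, h⟩ := hC u hu
    have := saalDet_move_of_large hq hq0 (a₀ := a₀ * u) (a₁ := a₁ * u) (a₂ := a₂ / u ^ 2)
      (b := b) (lam := lam) (by field_simp; linear_combination hab) hl (fun j => (h j).1)
      (fun j => (h j).2) hs
    rwa [mul_right_comm a₀, show a₁ * u / s = a₁ / s * u by ring] at this

/-! ### Symmetries, and dependence on the products only. -/

lemma saalSeries_rotate (q x₀ x₁ x₂ : ℂ) (y : Fin 3 → ℂ) :
    saalSeries q ![x₀, x₁, x₂] y = saalSeries q ![x₂, x₀, x₁] y := by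
  have h1 : saalTerm q ![x₀, x₁, x₂] y = saalTerm q ![x₂, x₀, x₁] y := by
    ext k
    simp only [saalTerm, Fin.prod_univ_three, Matrix.cons_val_zero, Matrix.cons_val_one,
      Matrix.cons_val]
    ring
  have h2 : saalTerm q y ![x₀, x₁, x₂] = saalTerm q y ![x₂, x₀, x₁] := by
    ext k
    simp only [saalTerm, Fin.prod_univ_three, Matrix.cons_val_zero, Matrix.cons_val_one,
      Matrix.cons_val]
    ring
  rw [saalSeries, saalSeries, h1, h2]

lemma saalDet_rotate (q a₀ a₁ a₂ : ℂ) (b lam : Fin 3 → ℂ) :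
    saalDet q ![a₀, a₁, a₂] b lam = saalDet q ![a₂, a₀, a₁] b lam := by
  have e : ∀ (x₀ x₁ x₂ l : ℂ), (fun k => (![x₀, x₁, x₂] : Fin 3 → ℂ) k * l) =
      ![x₀ * l, x₁ * l, x₂ * l] := by
    intro x₀ x₁ x₂ l; ext k; fin_cases k <;> rfl
  have h : ∀ l, f₂ q ![a₀, a₁, a₂] l = f₂ q ![a₂, a₀, a₁] l := fun l => by
    simp only [f₂, Fin.prod_univ_three, Matrix.cons_val_zero, Matrix.cons_val_one,
      Matrix.cons_val]
    ring
  simp only [saalDet, e, h, saalSeries_rotate q (a₀ * _)]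

/-- Inverting `lam` turns `f₁` into `f₂` and conversely, so the sign comes from exchanging two
columns. This carries results about `a` over to `b`. -/
lemma saalDet_swap {q : ℂ} (hq : ‖q‖ < 1) (a b lam : Fin 3 → ℂ) :
    saalDet q a b lam = -saalDet q b a (fun i => (lam i)⁻¹) := by
  simp only [saalDet, Matrix.det_fin_three, Matrix.of_apply, Matrix.cons_val_zero,
    Matrix.cons_val_one, Matrix.cons_val, f₁, f₂, div_inv_eq_mul, inv_inv, ← div_eq_mul_inv,
    saalSeries_comm hq (fun k => b k / _)]
  ring

lemma saalDet_mul_prod_phi {q : ℂ} (hq : ‖q‖ < 1) (hq0 : q ≠ 0) {a a' b lam : Fin 3 → ℂ}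
    (hab : (∏ j, a j) * (∏ j, b j) = q) (hab' : (∏ j, a' j) * (∏ j, b j) = q)
    (hl : ∀ i, lam i ≠ 0) (h : phi q b (a 0 * a 1 / a' 0) ≠ 0) :
    saalDet q a b lam * ∏ i, phi q b (a' i) = saalDet q a' b lam * ∏ i, phi q b (a i) := by
  have ha : ∀ j, a j ≠ 0 := fun j h => hq0 <| by
    rw [← hab, prod_eq_zero (mem_univ j) h, zero_mul]
  have ha' : ∀ j, a' j ≠ 0 := fun j h => hq0 <| by
    rw [← hab', prod_eq_zero (mem_univ j) h, zero_mul]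
  have hb : ∏ j, b j ≠ 0 := fun h => hq0 <| by rw [← hab, h, mul_zero]
  have hprod : ∏ j, a j = ∏ j, a' j := mul_right_cancel₀ hb (hab.trans hab'.symm)
  have e : ∀ c : Fin 3 → ℂ, c = ![c 0, c 1, c 2] := fun c => by
    ext k; fin_cases k <;> rfl
  have h0 := ha 0
  have h1 := ha 1
  have h2 := ha 2
  have h0' := ha' 0
  have h1' := ha' 1
  have h2' := ha' 2
  rw [Fin.prod_univ_three, Fin.prod_univ_three] at hprod
  rw [Fin.prod_univ_three] at hab
  -- Two moves, through the triple `(a' 0, a 0 * a 1 / a' 0, a 2)`; hypothesis `h` lets the factor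
  -- of the intermediate entry be cancelled.
  have m1 := saalDet_move hq hq0 hab hl (s := a' 0 / a 0) (div_ne_zero h0' h0)
  have m2 := saalDet_move hq hq0 (a₀ := a 0 * a 1 / a' 0) (a₁ := a 2) (a₂ := a' 0) (b := b)
    (by rw [← hab]; field_simp) hl (s := a' 1 * a' 0 / (a 0 * a 1))
    (div_ne_zero (mul_ne_zero h1' h0') (mul_ne_zero h0 h1))
  rw [mul_div_cancel₀ _ h0, show a 1 / (a' 0 / a 0) = a 0 * a 1 / a' 0 by field_simp, ← e] at m1
  rw [show a 0 * a 1 / a' 0 * (a' 1 * a' 0 / (a 0 * a 1)) = a' 1 by field_simp,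
    show a 2 / (a' 1 * a' 0 / (a 0 * a 1)) = a' 2 by field_simp; linear_combination hprod,
    saalDet_rotate, saalDet_rotate q _ (a 2), ← e] at m2
  rw [Fin.prod_univ_three, Fin.prod_univ_three]
  refine mul_right_cancel₀ h ?_
  linear_combination -(phi q b (a' 1) * phi q b (a' 2)) * m1 - phi q b (a 0) * phi q b (a 1) * m2

lemma prod_phi_comm (q : ℂ) (a b : Fin 3 → ℂ) : ∏ i, phi q b (a i) = ∏ i, phi q a (b i) := by
  simp only [phi, Fin.prod_univ_three, mul_comm (b _) (a _)]
  ring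

lemma saalDet_mul_prod_phi_right {q : ℂ} (hq : ‖q‖ < 1) (hq0 : q ≠ 0) {a b b' lam : Fin 3 → ℂ}
    (hab : (∏ j, a j) * (∏ j, b j) = q) (hab' : (∏ j, a j) * (∏ j, b' j) = q)
    (hl : ∀ i, lam i ≠ 0) (h : phi q a (b 0 * b 1 / b' 0) ≠ 0) :
    saalDet q a b lam * ∏ i, phi q b' (a i) = saalDet q a b' lam * ∏ i, phi q b (a i) := by
  rw [mul_comm] at hab hab'
  have := saalDet_mul_prod_phi hq hq0 hab hab' (fun i => inv_ne_zero (hl i)) h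
  rw [saalDet_swap hq a b, saalDet_swap hq a b', prod_phi_comm q a b, prod_phi_comm q a b',
    neg_mul, neg_mul, this]

lemma prod_prod_Ioi_fin_three (g : Fin 3 → Fin 3 → ℂ) :
    ∏ i, ∏ j ∈ Ioi i, g i j = g 0 1 * g 0 2 * g 1 2 := by
  have h0 : Ioi (0 : Fin 3) = {1, 2} := by decide
  have h1 : Ioi (1 : Fin 3) = {2} := by decide
  have h2 : Ioi (2 : Fin 3) = ∅ := by decide
  rw [Fin.prod_univ_three, h0, h1, h2, prod_pair (by decide), prod_singleton, prod_empty, mul_one]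

/-! ### The special evaluation. -/

/-- The factor by which the determinant differs from `∏ᵢⱼ (q/aᵢbⱼ)_∞`. -/
def saalFactor (q t : ℂ) (lam : Fin 3 → ℂ) : ℂ :=
  qPochInf q q * theta q (t * ∏ i, lam i) / (∏ i, lam i) *
    ∏ i, ∏ j ∈ Ioi i, lam j * theta q (lam i / lam j)

lemma saalTerm_succ_of_eq_one {q : ℂ} {x : Fin 3 → ℂ} (hx : x 0 = 1) (y : Fin 3 → ℂ) (k : ℕ) :
    saalTerm q x y (k + 1) = 0 := by
  rw [saalTerm, prod_eq_zero (mem_univ 0), mul_zero]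
  rw [hx, qPochNat_one_succ]
  ring

lemma saalSeries_of_eq_one {q : ℂ} {x y : Fin 3 → ℂ} (hx : x 0 = 1) (hy : y 0 = 1) :
    saalSeries q x y = ∏ j, (qPochInf q (q / x j) * qPochInf q (q / y j)) := by
  rw [saalSeries, tsum_eq_single 0, tsum_congr fun k => saalTerm_succ_of_eq_one hy x k, tsum_zero,
    add_zero, saalTerm]
  · simp
  · intro k hk
    obtain ⟨m, rfl⟩ := Nat.exists_eq_succ_of_ne_zero hk
    exact saalTerm_succ_of_eq_one hx y m

/-- The first row is `(0, 0, *)`, its last entry being a one-term series. Since `f₁` also vanishes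
at `lam 1` and `f₂` at `lam 2`, the determinant is a single product. -/
lemma saalDet_special {q : ℂ} (hq : ‖q‖ < 1) (hq0 : q ≠ 0) {t : ℂ} (ht : t ≠ 0)
    {lam : Fin 3 → ℂ} (hl : ∀ i, lam i ≠ 0) :
    saalDet q ![1 / lam 0, 1 / lam 2, t * lam 0 * lam 2]
        ![lam 0, lam 1, q / (t * lam 0 * lam 1)] lam =
      saalFactor q t lam * ∏ i, phi q ![lam 0, lam 1, q / (t * lam 0 * lam 1)]
        (![1 / lam 0, 1 / lam 2, t * lam 0 * lam 2] i) := by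
  have h0 := hl 0
  have h1 := hl 1
  have h2 := hl 2
  rw [saalFactor, prod_prod_Ioi_fin_three]
  have hF : saalSeries q (fun k => ![1 / lam 0, 1 / lam 2, t * lam 0 * lam 2] k * lam 0)
      (fun k => ![lam 0, lam 1, q / (t * lam 0 * lam 1)] k / lam 0) = _ :=
    saalSeries_of_eq_one (by simp [h0]) (by simp [h0])
  have hθ : theta q (lam 1 / lam 0) = -(lam 1 / lam 0) * theta q (lam 0 / lam 1) := by
    rw [← inv_div, theta_inv hq hq0 (div_ne_zero h0 h1)]
  simp only [saalDet, Matrix.det_fin_three, Matrix.of_apply, Matrix.cons_val_zero,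
    Matrix.cons_val_one, Matrix.cons_val, hF]
  simp only [f₁, f₂, phi, Fin.prod_univ_three, Matrix.cons_val_zero, Matrix.cons_val_one,
    Matrix.cons_val, one_div_mul_cancel h0, one_div_mul_cancel h2, div_self h0, div_self h1,
    theta_one hq]
  generalize lam 0 = x at *
  generalize lam 1 = y at *
  generalize lam 2 = z at *
  have e1 : q / (1 / z * x) = q * z / x := by field_simp
  have e2 : q / (y / x) = q * x / y := by field_simp
  have e3 : q / (q / (t * x * y) / x) = t * x ^ 2 * y := by field_simp
  have e4 : theta q (q / (t * x * y) / z) = theta q (t * (x * y * z)) := by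
    rw [← theta_q_div hq0 (x := t * (x * y * z))]
    congr 1
    field_simp
  have e6 : q / (1 / x * (q / (t * x * y))) = t * x ^ 2 * y := by field_simp
  have e8 : q / (1 / z * (q / (t * x * y))) = t * (x * y * z) := by field_simp
  have e10 : q / (t * x * z * (q / (t * x * y))) = y / z := by field_simp
  have e11 : t * x * z * x = t * x ^ 2 * z := by ring
  have e12 : 1 / x * y = y / x := by ring
  have e13 : 1 / z * y = y / z := by ring
  have e14 : t * x * z * y = t * (x * y * z) := by ring
  simp only [e1, e2, e3, e4, e6, e8, e10, e11, e12, e13, e14, hθ, div_one]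
  have t1 : theta q (y / z) = qPochInf q (y / z) * qPochInf q (q / (y / z)) := rfl
  have t2 : theta q (t * (x * y * z)) =
    qPochInf q (t * (x * y * z)) * qPochInf q (q / (t * (x * y * z))) := rfl
  generalize qPochInf q (y / z) = A1 at *
  generalize qPochInf q (q / (y / z)) = A2 at *
  generalize qPochInf q (t * (x * y * z)) = A3 at *
  generalize qPochInf q (q / (t * (x * y * z))) = A4 at *
  rw [t1, t2]
  field_simp
  ring

lemma saalDet_eq_of_generic {q : ℂ} (hq : ‖q‖ < 1) (hq0 : q ≠ 0) {a b lam : Fin 3 → ℂ} {t : ℂ}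
    (hab : (∏ j, a j) * (∏ j, b j) = q) (ht : t = ∏ j, a j) (hl : ∀ i, lam i ≠ 0)
    (h1 : phi q b (a 0 * a 1 * lam 0) ≠ 0)
    (h2 : phi q ![1 / lam 0, 1 / lam 2, t * lam 0 * lam 2] (b 0 * b 1 / lam 0) ≠ 0)
    (h3 : ∏ i, phi q b (![1 / lam 0, 1 / lam 2, t * lam 0 * lam 2] i) ≠ 0)
    (h4 : ∏ i, phi q ![lam 0, lam 1, q / (t * lam 0 * lam 1)]
        (![1 / lam 0, 1 / lam 2, t * lam 0 * lam 2] i) ≠ 0) :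
    saalDet q a b lam = saalFactor q t lam * ∏ i, phi q b (a i) := by
  have ht0 : t ≠ 0 := by
    rintro rfl
    rw [← ht, zero_mul] at hab
    exact hq0 hab.symm
  have l0 := hl 0
  have l1 := hl 1
  have l2 := hl 2
  have hpa : ∏ j, ![1 / lam 0, 1 / lam 2, t * lam 0 * lam 2] j = t := by
    simp only [Fin.prod_univ_three, Matrix.cons_val_zero, Matrix.cons_val_one, Matrix.cons_val]
    field_simp
  have hpb : ∏ j, ![lam 0, lam 1, q / (t * lam 0 * lam 1)] j = q / t := by
    simp only [Fin.prod_univ_three, Matrix.cons_val_zero, Matrix.cons_val_one, Matrix.cons_val]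
    field_simp
  have m1 := saalDet_mul_prod_phi hq hq0 (a' := ![1 / lam 0, 1 / lam 2, t * lam 0 * lam 2])
    hab (by rw [hpa, ht, hab]) hl (by simpa using h1)
  have m2 := saalDet_mul_prod_phi_right hq hq0
    (a := ![1 / lam 0, 1 / lam 2, t * lam 0 * lam 2])
    (b := b) (b' := ![lam 0, lam 1, q / (t * lam 0 * lam 1)])
    (by rw [hpa, ht, hab]) (by rw [hpa, hpb]; field_simp) hl (by simpa using h2)
  rw [saalDet_special hq hq0 ht0 hl] at m2
  refine mul_right_cancel₀ h3 (mul_right_cancel₀ h4 ?_)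
  linear_combination (∏ i, phi q ![lam 0, lam 1, q / (t * lam 0 * lam 1)]
        (![1 / lam 0, 1 / lam 2, t * lam 0 * lam 2] i)) * m1 + (∏ i, phi q b (a i)) * m2

/-! ### Removal of the genericity conditions. -/

/-- A zero forces `c E^k q^n = 1` for some `n`. With `E = exp x`, taking norms leaves at most one
real `x` for each `n`, hence a null set. -/
lemma ae_qPochInf_ne_zero {q : ℂ} (hq : ‖q‖ < 1) {g : ℂ → ℂ} {c : ℂ} {k : ℤ}
    (hk : k ≠ 0) (hg : ∀ E, E ≠ 0 → g E = c * E ^ k) :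
    ∀ᵐ x : ℝ, qPochInf q (g (Complex.exp x)) ≠ 0 := by
  have hsub : {x : ℝ | ¬ qPochInf q (g (Complex.exp x)) ≠ 0} ⊆
      ⋃ n : ℕ, {Real.log (‖c * q ^ n‖⁻¹) / k} := by
    intro x hx
    by_contra hcon
    refine hx (qPochInf_ne_zero hq fun n hn => hcon (Set.mem_iUnion.2 ⟨n, ?_⟩))
    rw [Set.mem_singleton_iff, eq_div_iff (by exact_mod_cast hk)]
    rw [hg _ (Complex.exp_ne_zero _), mul_right_comm] at hn
    have h2 := congrArg norm hn
    rw [norm_mul, norm_zpow, Complex.norm_exp, Complex.ofReal_re, norm_one] at h2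
    rw [← eq_inv_of_mul_eq_one_right h2, Real.log_zpow, Real.log_exp, mul_comm]
  exact MeasureTheory.measure_mono_null hsub
    ((Set.countable_iUnion fun n => Set.countable_singleton _).measure_zero MeasureTheory.volume)

/-- The weights 1, 2, 4 make every argument that occurs a monomial in `exp x` with nonzero exponent,
apart from one that is constantly `q`. -/
lemma ae_generic {q : ℂ} (hq : ‖q‖ < 1) (hq0 : q ≠ 0) {a b lam : Fin 3 → ℂ} {t : ℂ}
    (ha : ∀ i, a i ≠ 0) (hb : ∀ i, b i ≠ 0) (ht : t ≠ 0) (hl : ∀ i, lam i ≠ 0) :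
    ∀ᵐ x : ℝ, ∀ mu : Fin 3 → ℂ, mu = ![lam 0 * Complex.exp x, lam 1 * Complex.exp x ^ 2,
        lam 2 * Complex.exp x ^ 4] →
      phi q b (a 0 * a 1 * mu 0) ≠ 0 ∧
      phi q ![1 / mu 0, 1 / mu 2, t * mu 0 * mu 2] (b 0 * b 1 / mu 0) ≠ 0 ∧
      ∏ i, phi q b (![1 / mu 0, 1 / mu 2, t * mu 0 * mu 2] i) ≠ 0 ∧
      ∏ i, phi q ![mu 0, mu 1, q / (t * mu 0 * mu 1)]
        (![1 / mu 0, 1 / mu 2, t * mu 0 * mu 2] i) ≠ 0 := by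
  have l0 := hl 0
  have l1 := hl 1
  have l2 := hl 2
  have a0 := ha 0
  have a1 := ha 1
  have b0 := hb 0
  have b1 := hb 1
  have hq1 : qPochInf q q ≠ 0 := qPochInf_ne_zero_of_norm_lt_one hq hq
  have A : ∀ᵐ x : ℝ, ∀ j, qPochInf q (q / (a 0 * a 1 * (lam 0 * Complex.exp x) * b j)) ≠ 0 :=
    Filter.eventually_all.2 fun j => by
      have := hb j
      exact ae_qPochInf_ne_zero hq (g := fun E => q / (a 0 * a 1 * (lam 0 * E) * b j))
        (c := q / (a 0 * a 1 * lam 0 * b j)) (k := -1) (by decide)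
        fun E hE => by field_simp
  have B0 := ae_qPochInf_ne_zero hq
    (g := fun E => q / (b 0 * b 1 / (lam 0 * E) * (1 / (lam 0 * E))))
    (c := q / (b 0 * b 1 / lam 0 * (1 / lam 0))) (k := 2) (by decide)
    fun E hE => by field_simp
  have B1 := ae_qPochInf_ne_zero hq
    (g := fun E => q / (b 0 * b 1 / (lam 0 * E) * (1 / (lam 2 * E ^ 4))))
    (c := q / (b 0 * b 1 / lam 0 * (1 / lam 2))) (k := 5) (by decide)
    fun E hE => by field_simp
  have B2 := ae_qPochInf_ne_zero hq
    (g := fun E => q / (b 0 * b 1 / (lam 0 * E) * (t * (lam 0 * E) * (lam 2 * E ^ 4))))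
    (c := q / (b 0 * b 1 / lam 0 * (t * lam 0 * lam 2))) (k := -4) (by decide)
    fun E hE => by field_simp
  have C0 : ∀ᵐ x : ℝ, ∀ j, qPochInf q (q / (1 / (lam 0 * Complex.exp x) * b j)) ≠ 0 :=
    Filter.eventually_all.2 fun j => by
      have := hb j
      exact ae_qPochInf_ne_zero hq (g := fun E => q / (1 / (lam 0 * E) * b j))
        (c := q / (1 / lam 0 * b j)) (k := 1) (by decide)
        fun E hE => by field_simp
  have C1 : ∀ᵐ x : ℝ, ∀ j, qPochInf q (q / (1 / (lam 2 * Complex.exp x ^ 4) * b j)) ≠ 0 :=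
    Filter.eventually_all.2 fun j => by
      have := hb j
      exact ae_qPochInf_ne_zero hq (g := fun E => q / (1 / (lam 2 * E ^ 4) * b j))
        (c := q / (1 / lam 2 * b j)) (k := 4) (by decide)
        fun E hE => by field_simp
  have C2 : ∀ᵐ x : ℝ, ∀ j, qPochInf q
      (q / (t * (lam 0 * Complex.exp x) * (lam 2 * Complex.exp x ^ 4) * b j)) ≠ 0 :=
    Filter.eventually_all.2 fun j => by
      have := hb j
      exact ae_qPochInf_ne_zero hq (g := fun E => q / (t * (lam 0 * E) * (lam 2 * E ^ 4) * b j))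
        (c := q / (t * lam 0 * lam 2 * b j)) (k := -5) (by decide)
        fun E hE => by field_simp
  have D01 := ae_qPochInf_ne_zero hq
    (g := fun E => q / (1 / (lam 0 * E) * (lam 1 * E ^ 2)))
    (c := q / (1 / lam 0 * lam 1)) (k := -1) (by decide)
    fun E hE => by field_simp
  have D02 := ae_qPochInf_ne_zero hq
    (g := fun E => q / (1 / (lam 0 * E) * (q / (t * (lam 0 * E) * (lam 1 * E ^ 2)))))
    (c := q / (1 / lam 0 * (q / (t * lam 0 * lam 1)))) (k := 4) (by decide)
    fun E hE => by field_simp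
  have D10 := ae_qPochInf_ne_zero hq
    (g := fun E => q / (1 / (lam 2 * E ^ 4) * (lam 0 * E)))
    (c := q / (1 / lam 2 * lam 0)) (k := 3) (by decide)
    fun E hE => by field_simp
  have D11 := ae_qPochInf_ne_zero hq
    (g := fun E => q / (1 / (lam 2 * E ^ 4) * (lam 1 * E ^ 2)))
    (c := q / (1 / lam 2 * lam 1)) (k := 2) (by decide)
    fun E hE => by field_simp
  have D12 := ae_qPochInf_ne_zero hq
    (g := fun E => q / (1 / (lam 2 * E ^ 4) * (q / (t * (lam 0 * E) * (lam 1 * E ^ 2)))))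
    (c := q / (1 / lam 2 * (q / (t * lam 0 * lam 1)))) (k := 7) (by decide)
    fun E hE => by field_simp
  have D20 := ae_qPochInf_ne_zero hq
    (g := fun E => q / (t * (lam 0 * E) * (lam 2 * E ^ 4) * (lam 0 * E)))
    (c := q / (t * lam 0 * lam 2 * lam 0)) (k := -6) (by decide)
    fun E hE => by field_simp
  have D21 := ae_qPochInf_ne_zero hq
    (g := fun E => q / (t * (lam 0 * E) * (lam 2 * E ^ 4) * (lam 1 * E ^ 2)))
    (c := q / (t * lam 0 * lam 2 * lam 1)) (k := -7) (by decide)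
    fun E hE => by field_simp
  have D22 := ae_qPochInf_ne_zero hq
    (g := fun E => q / (t * (lam 0 * E) * (lam 2 * E ^ 4) * (q / (t * (lam 0 * E) * (lam 1 * E ^ 2)))))
    (c := q / (t * lam 0 * lam 2 * (q / (t * lam 0 * lam 1)))) (k := -2) (by decide)
    fun E hE => by field_simp
  filter_upwards [A, B0, B1, B2, C0, C1, C2, D01, D02, D10, D11, D12, D20, D21, D22] with
    x A B0 B1 B2 C0 C1 C2 D01 D02 D10 D11 D12 D20 D21 D22
  rintro mu rfl
  have D00 : qPochInf q (q / (1 / (lam 0 * Complex.exp x) * (lam 0 * Complex.exp x))) ≠ 0 := by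
    have := Complex.exp_ne_zero x
    rwa [one_div_mul_cancel (mul_ne_zero l0 this), div_one]
  simp only [phi, Fin.prod_univ_three, Matrix.cons_val_zero, Matrix.cons_val_one, Matrix.cons_val]
  exact ⟨mul_ne_zero (mul_ne_zero (A 0) (A 1)) (A 2), mul_ne_zero (mul_ne_zero B0 B1) B2,
    mul_ne_zero (mul_ne_zero (mul_ne_zero (mul_ne_zero (C0 0) (C0 1)) (C0 2))
      (mul_ne_zero (mul_ne_zero (C1 0) (C1 1)) (C1 2)))
      (mul_ne_zero (mul_ne_zero (C2 0) (C2 1)) (C2 2)),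
    mul_ne_zero (mul_ne_zero (mul_ne_zero (mul_ne_zero D00 D01) D02)
      (mul_ne_zero (mul_ne_zero D10 D11) D12)) (mul_ne_zero (mul_ne_zero D20 D21) D22)⟩

lemma saalDet_eq {q : ℂ} (hq : ‖q‖ < 1) (hq0 : q ≠ 0) {a b lam : Fin 3 → ℂ} {t : ℂ}
    (hab : (∏ j, a j) * (∏ j, b j) = q) (ht : t = ∏ j, a j) (hl : ∀ i, lam i ≠ 0) :
    saalDet q a b lam = saalFactor q t lam * ∏ i, phi q b (a i) := by
  have ha : ∀ j, a j ≠ 0 := fun j h => hq0 <| by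
    rw [← hab, prod_eq_zero (mem_univ j) h, zero_mul]
  have hb : ∀ j, b j ≠ 0 := fun j h => hq0 <| by
    rw [← hab, prod_eq_zero (mem_univ j) h, mul_zero]
  have ht0 : t ≠ 0 := ht ▸ prod_ne_zero_iff.2 fun j _ => ha j
  let mu : ℂ → Fin 3 → ℂ := fun z =>
    ![lam 0 * Complex.exp z, lam 1 * Complex.exp z ^ 2, lam 2 * Complex.exp z ^ 4]
  have hmu0 : ∀ i, ∀ z ∈ (Set.univ : Set ℂ), mu z i ≠ 0 := by
    intro i z _
    have := Complex.exp_ne_zero z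
    fin_cases i
    exacts [mul_ne_zero (hl 0) this, mul_ne_zero (hl 1) (pow_ne_zero 2 this),
      mul_ne_zero (hl 2) (pow_ne_zero 4 this)]
  have hmu : ∀ i, DifferentiableOn ℂ (fun z => mu z i) Set.univ := by
    intro i
    fin_cases i
    · change DifferentiableOn ℂ (fun z => lam 0 * Complex.exp z) _
      fun_prop
    · change DifferentiableOn ℂ (fun z => lam 1 * Complex.exp z ^ 2) _
      fun_prop
    · change DifferentiableOn ℂ (fun z => lam 2 * Complex.exp z ^ 4) _
      fun_prop
  have hD : DifferentiableOn ℂ (fun z => saalDet q a b (mu z)) Set.univ :=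
    DifferentiableOn.saalDet hq isOpen_univ (fun j => differentiableOn_const _)
      (fun j => differentiableOn_const _) hmu (fun j _ _ => ha j) (fun j _ _ => hb j) hmu0
  have hprod : DifferentiableOn ℂ (fun z => ∏ i, mu z i) Set.univ :=
    DifferentiableOn.fun_finsetProd fun i _ => hmu i
  have hprod0 : ∀ z ∈ (Set.univ : Set ℂ), ∏ i, mu z i ≠ 0 := fun z hz =>
    prod_ne_zero_iff.2 fun i _ => hmu0 i z hz
  have hF : DifferentiableOn ℂ (fun z => saalFactor q t (mu z)) Set.univ := by
    refine DifferentiableOn.mul (DifferentiableOn.div (DifferentiableOn.const_mul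
      (DifferentiableOn.theta hq (hprod.const_mul t) fun z hz => mul_ne_zero ht0 (hprod0 z hz)) _)
      hprod hprod0) ?_
    exact DifferentiableOn.fun_finsetProd fun i _ => DifferentiableOn.fun_finsetProd fun j _ =>
      (hmu j).mul (DifferentiableOn.theta hq ((hmu i).div (hmu j) (hmu0 j))
        fun z hz => div_ne_zero (hmu0 i z hz) (hmu0 j z hz))
  have hDc := (differentiableOn_univ.1 hD).continuous.comp Complex.continuous_ofReal
  have hFc := ((differentiableOn_univ.1 hF).continuous.mul
    (continuous_const (y := ∏ i, phi q b (a i)))).comp Complex.continuous_ofReal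
  -- A set of full measure is dense, so continuity along this real curve gives the identity at `x =
  -- 0`, where the curve passes through `lam`.
  have hdense := MeasureTheory.Measure.dense_of_ae (ae_generic hq hq0 ha hb ht0 hl)
  have key := Continuous.ext_on hdense hDc hFc fun x hx => by
    obtain ⟨h1, h2, h3, h4⟩ := hx (mu x) rfl
    exact saalDet_eq_of_generic hq hq0 hab ht (fun i => hmu0 i x trivial) h1 h2 h3 h4
  have hmu_zero : mu 0 = lam := by
    ext i; fin_cases i <;> simp [mu]
  simpa [hmu_zero] using congrFun key 0

end BilateralSaalschutz

end

/-! ### The theorem, by translation from `saalSeries` back to `f₃`. -/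

theorem mainTheorem5 (q : ℂ) (hq0 : 0 < ‖q‖) (hq1 : ‖q‖ < 1)
    (a b lam : Fin 3 → ℂ) (t : ℂ)
    (hbal : (∏ j, a j) * (∏ j, b j) = q)
    (ht : t = ∏ j, a j)
    (hlam : ∀ i, lam i ≠ 0)
    (hgen_a : ∀ i j, ∀ n : ℕ, a j * lam i ≠ q ^ (n + 1))
    (hgen_b : ∀ i j, ∀ n : ℕ, q * lam i / b j * q ^ n ≠ 1) :
    (∀ i, Summable fun k : ℤ =>
      BilateralSaalschutz.psiTerm q (fun j => a j * lam i) (fun j => q * lam i / b j) q k) ∧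
    Matrix.det (Matrix.of fun i j : Fin 3 =>
        (![BilateralSaalschutz.f₁ q b, BilateralSaalschutz.f₂ q a,
          BilateralSaalschutz.f₃ q a b] j) (lam i)) =
      BilateralSaalschutz.qPochInf q q * BilateralSaalschutz.theta q (t * ∏ i, lam i) /
          (∏ i, lam i) *
        (∏ i, ∏ j, BilateralSaalschutz.qPochInf q (q / (a i * b j))) *
        ∏ i, ∏ j ∈ Finset.Ioi i, lam j * BilateralSaalschutz.theta q (lam i / lam j) := by
  have hq : q ≠ 0 := norm_pos_iff.1 hq0
  have hxy : ∀ i, (∏ j, a j * lam i) * (∏ j, b j / lam i) = q := fun i => by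
    have := hlam i
    rw [Finset.prod_mul_distrib, Finset.prod_div_distrib, Finset.prod_const]
    field_simp
    exact hbal
  have hdiv : ∀ i j, q * lam i / b j = q / (b j / lam i) := fun i j => by
    rw [div_div_eq_mul_div]
  simp only [hdiv] at hgen_b ⊢
  refine ⟨fun i => BilateralSaalschutz.summable_psiTerm hq1 hq (hxy i) (hgen_a i) (hgen_b i), ?_⟩
  have h3 : ∀ i, BilateralSaalschutz.f₃ q a b (lam i) =
      BilateralSaalschutz.saalSeries q (fun k => a k * lam i) (fun k => b k / lam i) := fun i => by
    rw [← BilateralSaalschutz.prod_mul_psi hq1 hq (hxy i) (hgen_a i) (hgen_b i),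
      BilateralSaalschutz.f₃]
    simp only [hdiv]
  have h := BilateralSaalschutz.saalDet_eq hq1 hq hbal ht hlam
  rw [BilateralSaalschutz.saalFactor, mul_right_comm] at h
  refine Eq.trans ?_ h
  rw [BilateralSaalschutz.saalDet]
  congr 1
  ext i j
  fin_cases j
  exacts [rfl, rfl, h3 i]
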